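/- Let $n\ge 2$ and let $G\subset U(2^n)$ be the $n$-qubit matchgate group, i.e. the group generated by the gates $G(A,B)$ with $A,B\in SU(2)$ acting on neighbouring qubits $k,k+1$ of a line ($1\le k<n$) and as the identity on the other qubits, where $G(A,B)$ acts as $A$ on $\mathrm{span}\{|00\rangle,|11\rangle\}$ and as $B$ on $\mathrm{span}\{|01\rangle,|10\rangle\}$. Its natural representation is $U\mapsto \hat U=U\otimes U^*$ on $\mathcal H\otimes\mathcal H$ with $\mathcal H=(\mathbb C^2)^{\otimes n}$; equivalently $\rho\mapsto U\rho U^\dagger$ under $|\rho\rangle\rangle=\sum_{x,y}\rho_{xy}|x\rangle\otimes|y\rangle$. Let $c_{2k-1}=Z_1\cdots Z_{k-1}X_k$ and $c_{2k}=Z_1\cdots Z_{k-1}Y_k$ $(1\le k\le n)$ be the Majorana operators, let $|m_1\cdots m_i\rangle\rangle$ be the vectorization of $2^{-n/2}c_{m_1}\cdots c_{m_i}$ for $1\le m_1<\cdots<m_i\le 2n$, and let $\mathcal H_i$ be the span of all $|m_1\cdots m_i\rangle\rangle$ of degree $i$, for $0\le i\le 2n$. For $\ell_1<\cdots<\ell_i$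 let $m_1<\cdots<m_{2n-i}$ be the complement of $\{\ell_1,\dots,\ell_i\}$ in $\{1,\dots,2n\}$ and let $(-1)^{\sigma(\ell,m)}$ be the sign of the permutation $(\ell_1,\dots,\ell_i,m_1,\dots,m_{2n-i})\mapsto(1,\dots,2n)$. Put $$\mathcal H_{n,1}=\mathrm{span}\{|\ell_1\cdots\ell_n\rangle\rangle+\mathrm i^n(-1)^{\sigma(\ell,m)}|m_1\cdots m_n\rangle\rangle\},\qquad \mathcal H_{n,2}=\mathrm{span}\{|\ell_1\cdots\ell_n\rangle\rangle-\mathrm i^n(-1)^{\sigma(\ell,m)}|m_1\cdots m_n\rangle\rangle\}.$$ Then: 1. The $4^n$ vectors $|m_1\cdots m_i\rangle\rangle$ are orthonormal. There is a homomorphism $R:G\to SO(2n)$ with $Uc_\ell U^\dagger=\sum_m R(U)_{m\ell}\,c_m$ for all $U\in G$ and all $\ell$. Each $\mathcal H_i$ is a subrepresentation of the natural representation, and $e_{m_1}\wedge\cdots\wedge e_{m_i}\mapsto|m_1\cdots m_i\rangle\rangle$ is an isomorphism of representations $\bigwedge^i\mathbb C^{2n}\cong\mathcal H_i$, where $G$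 acts on $\mathbb C^{2n}$ through $R$. 2. $\mathcal H_{n,1}$ and $\mathcal H_{n,2}$ are subrepresentations, $\mathcal H_n=\mathcal H_{n,1}\oplus\mathcal H_{n,2}$, and $$\mathcal H\otimes\mathcal H=\mathcal H_0\oplus\cdots\oplus\mathcal H_{n-1}\oplus\mathcal H_{n,1}\oplus\mathcal H_{n,2}\oplus\mathcal H_{n+1}\oplus\cdots\oplus\mathcal H_{2n},$$ where all the summands on the right are irreducible. 3. For $0\le i\le 2n$ the Hodge star $|\ell_1\cdots\ell_i\rangle\rangle\mapsto(-1)^{\sigma(\ell,m)}|m_1\cdots m_{2n-i}\rangle\rangle$ is an isomorphism of representations $\mathcal H_i\to\mathcal H_{2n-i}$; in particular $\mathcal H_i\cong\mathcal H_{2n-i}$ for $i\ne n$. Apart from these, no two distinct summands in 2 are isomorphic. 4. If $n$ is even, then $\mathcal H_{n,1}$ and $\mathcal H_{n,2}$ are real representations (each has a basis in which all matrices are real). If $n$ is odd, they are complex conjugates of each other (there is an equivariant conjugate-linear bijection between them). -/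

import Mathlib

open scoped Kronecker Matrix

noncomputable section

/-- Operators on `n` qubits, as matrices in the computational basis. -/
abbrev QubitOp (n : ℕ) : Type := Matrix (Fin n → Fin 2) (Fin n → Fin 2) ℂ

/-- The Liouville space `ℋ ⊗ ℋ` of `n` qubits, in coordinates with respect to `|x⟩ ⊗ |y⟩`. -/
abbrev LiouvilleSpace (n : ℕ) : Type := (Fin n → Fin 2) × (Fin n → Fin 2) → ℂ

/-- The vectorization `|ρ⟩⟩ = ∑ ρ_{xy} |x⟩ ⊗ |y⟩`. -/
def liouvilleVec {n : ℕ} (ρ : QubitOp n) : LiouvilleSpace n := fun p => ρ p.1 p.2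

/-! ### The matchgate group -/

/-- The matchgate `G(A, B)`: it acts as `A` on the span of `|00⟩, |11⟩` and as `B` on the span of
`|01⟩, |10⟩`. Inside each of the two blocks the first bit says which vector is meant. -/
def matchgate (A B : Matrix (Fin 2) (Fin 2) ℂ) : Matrix (Fin 2 × Fin 2) (Fin 2 × Fin 2) ℂ :=
  Matrix.of fun p q =>
    if p.1 = p.2 ∧ q.1 = q.2 then A p.1 q.1
    else if p.1 ≠ p.2 ∧ q.1 ≠ q.2 then B p.1 q.1
    else 0

/-- The usual `4 × 4` form of a matchgate, in the order `|00⟩, |01⟩, |10⟩, |11⟩`. -/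
theorem matchgate_eq (A B : Matrix (Fin 2) (Fin 2) ℂ) :
    (matchgate A B).submatrix ![(0, 0), (0, 1), (1, 0), (1, 1)] ![(0, 0), (0, 1), (1, 0), (1, 1)] =
      !![A 0 0, 0, 0, A 0 1;
         0, B 0 0, B 0 1, 0;
         0, B 1 0, B 1 1, 0;
         A 1 0, 0, 0, A 1 1] := by
  ext i j
  fin_cases i <;> fin_cases j <;> simp [matchgate]

/-- The two-qubit operator `M` acting on the qubits `k` and `k'` of `n` qubits, and as the
identity on the others. -/
def onQubits {n : ℕ} (k k' : Fin n) (M : Matrix (Fin 2 × Fin 2) (Fin 2 × Fin 2) ℂ) : QubitOp n :=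
  Matrix.of fun x y =>
    if ∀ j, j ≠ k → j ≠ k' → x j = y j then M (x k, x k') (y k, y k') else 0

/-- The matchgate group on a line of `n` qubits: the group of unitaries generated by the
matchgates `G(A, B)`, with `A, B ∈ SU(2)`, on neighbouring qubits. -/
def matchgateGroup (n : ℕ) : Subgroup (Matrix.unitaryGroup (Fin n → Fin 2) ℂ) :=
  Subgroup.closure {U | ∃ k k' : Fin n, (k' : ℕ) = k + 1 ∧
    ∃ A ∈ Matrix.specialUnitaryGroup (Fin 2) ℂ, ∃ B ∈ Matrix.specialUnitaryGroup (Fin 2) ℂ,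
      (U : QubitOp n) = onQubits k k' (matchgate A B)}

/-- The operator on `n` qubits underlying an element of the matchgate group. -/
def gateOp {n : ℕ} (U : matchgateGroup n) : QubitOp n :=
  ((U : Matrix.unitaryGroup (Fin n → Fin 2) ℂ) : Matrix (Fin n → Fin 2) (Fin n → Fin 2) ℂ)

/-- The natural representation `U ↦ U ⊗ U*` of the matchgate group on Liouville space, where
`U*` is the entrywise complex conjugate. -/
def naturalRep (n : ℕ) : Representation ℂ (matchgateGroup n) (LiouvilleSpace n) where
  toFun U := Matrix.toLin' (gateOp U ⊗ₖ (gateOp U).map star)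
  map_one' := by
    have h : (gateOp (1 : matchgateGroup n)) = 1 := rfl
    rw [h, Matrix.map_one _ (star_zero _) (star_one _), Matrix.one_kronecker_one, Matrix.toLin'_one]
    rfl
  map_mul' U V := by
    have h : gateOp (U * V) = gateOp U * gateOp V := rfl
    have h' : (gateOp U * gateOp V).map star = (gateOp U).map star * (gateOp V).map star :=
      Matrix.map_mul (f := starRingEnd ℂ)
    rw [h, h', Matrix.mul_kronecker_mul, Matrix.toLin'_mul]
    rfl

/-- In terms of operators the natural representation is `ρ ↦ U ρ U†`. -/
theorem naturalRep_liouvilleVec {n : ℕ} (U : matchgateGroup n) (ρ : QubitOp n) :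
    naturalRep n U (liouvilleVec ρ) = liouvilleVec (gateOp U * ρ * (gateOp U)ᴴ) := by
  ext ⟨x, y⟩
  simp only [naturalRep, liouvilleVec, MonoidHom.coe_mk, OneHom.coe_mk, Matrix.toLin'_apply,
    Matrix.mulVec, dotProduct, Matrix.kroneckerMap_apply, Matrix.map_apply, Matrix.mul_apply,
    Matrix.conjTranspose_apply, Fintype.sum_prod_type, Finset.sum_mul]
  rw [Finset.sum_comm]
  refine Finset.sum_congr rfl fun _ _ => Finset.sum_congr rfl fun _ _ => ?_
  ring

/-! ### Majorana operators and Majorana monomials -/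

def pauliX : Matrix (Fin 2) (Fin 2) ℂ := !![0, 1; 1, 0]

def pauliY : Matrix (Fin 2) (Fin 2) ℂ := !![0, -Complex.I; Complex.I, 0]

def pauliZ : Matrix (Fin 2) (Fin 2) ℂ := !![1, 0; 0, -1]

/-- The tensor product `P_0 ⊗ ⋯ ⊗ P_{n-1}` of one-qubit operators. -/
def tensorOp {n : ℕ} (P : Fin n → Matrix (Fin 2) (Fin 2) ℂ) : QubitOp n :=
  Matrix.of fun x y => ∏ j, P j (x j) (y j)

/-- The Majorana operators. Counting from `0`, the operator with index `2k` is
`Z_0 ⋯ Z_{k-1} X_k` and the one with index `2k + 1` is `Z_0 ⋯ Z_{k-1} Y_k`. -/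
def majorana {n : ℕ} (m : Fin (2 * n)) : QubitOp n :=
  tensorOp fun j =>
    if (j : ℕ) < (m : ℕ) / 2 then pauliZ
    else if (j : ℕ) = (m : ℕ) / 2 then (if Even (m : ℕ) then pauliX else pauliY)
    else 1

/-- The normalized Majorana monomial `|m_1 ⋯ m_i⟩⟩`, that is, the vectorization of
`2^{-n/2} c_{m_1} ⋯ c_{m_i}`, where `m_1 < ⋯ < m_i` are the elements of `S`. -/
def majoranaKet {n : ℕ} (S : Finset (Fin (2 * n))) : LiouvilleSpace n :=
  liouvilleVec (((Real.sqrt 2 : ℂ) ^ n)⁻¹ • ((S.sort (· ≤ ·)).map majorana).prod)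

/-- The sign of the permutation that takes `(ℓ_1, …, ℓ_i, m_1, …, m_{N-i})` to `(1, …, N)`, where
`ℓ_1 < ⋯ < ℓ_i` are the elements of `S` and `m_1 < ⋯ < m_{N-i}` those of its complement. -/
def complementSign {N : ℕ} (S : Finset (Fin N)) : ℤˣ :=
  Equiv.Perm.sign
    ((finSumEquivOfFinset (s := S) rfl rfl).symm.trans
      (finSumFinEquiv.trans (finCongr (by simp : S.card + Sᶜ.card = N))))

/-- `H_i`, the span of the Majorana monomials of degree `i`. -/
def degreeSpace (n i : ℕ) : Submodule ℂ (LiouvilleSpace n) :=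
  Submodule.span ℂ {v | ∃ S : Finset (Fin (2 * n)), S.card = i ∧ v = majoranaKet S}

/-- `H_{n,1}` (for `ε = 1`) and `H_{n,2}` (for `ε = -1`): the span of the vectors
`|ℓ_1 ⋯ ℓ_n⟩⟩ + ε i^n (-1)^{σ(ℓ,m)} |m_1 ⋯ m_n⟩⟩`, with `m` the complement of `ℓ`. -/
def halfSpace (n : ℕ) (ε : ℤˣ) : Submodule ℂ (LiouvilleSpace n) :=
  Submodule.span ℂ {v | ∃ S : Finset (Fin (2 * n)), S.card = n ∧
    v = majoranaKet S +
      (((ε : ℤ) : ℂ) * Complex.I ^ n * ((complementSign S : ℤ) : ℂ)) • majoranaKet Sᶜ}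

/-! ### General representation theory -/

section Representation

variable {G : Type*} [Group G] {V W : Type*} [AddCommGroup V] [Module ℂ V]
  [AddCommGroup W] [Module ℂ W]

/-- The `i`-th exterior power of a representation. -/
def exteriorPowerRep (ρ : Representation ℂ G V) (i : ℕ) : Representation ℂ G (⋀[ℂ]^i V) where
  toFun g := exteriorPower.map i (ρ g)
  map_one' := by rw [map_one]; exact exteriorPower.map_id
  map_mul' g h := by rw [map_mul]; exact (exteriorPower.map_comp (n := i) (ρ h) (ρ g))

/-- A complex representation is real if its matrices are real in some basis. -/
def IsRealRep (ρ : Representation ℂ G V) : Prop :=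
  ∃ (d : ℕ) (b : Module.Basis (Fin d) ℂ V), ∀ g i j, (LinearMap.toMatrix b b (ρ g) i j).im = 0

/-- Two complex representations are complex conjugates of each other if there is an equivariant
conjugate-linear bijection between them. -/
def AreConjugateReps (ρ : Representation ℂ G V) (σ : Representation ℂ G W) : Prop :=
  ∃ J : V ≃ₛₗ[starRingEnd ℂ] W, ∀ g v, J (ρ g v) = σ g (J v)

end Representation

/-- The defining action of `SO(N)` on `ℂ^N`. -/
def specialOrthogonalRep (N : ℕ) :
    Representation ℂ (Matrix.specialOrthogonalGroup (Fin N) ℝ) (Fin N → ℂ) where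
  toFun R := Matrix.toLin' ((R : Matrix (Fin N) (Fin N) ℝ).map Complex.ofReal)
  map_one' := by
    have h : ((1 : Matrix.specialOrthogonalGroup (Fin N) ℝ) : Matrix (Fin N) (Fin N) ℝ) = 1 := rfl
    rw [h, Matrix.map_one _ Complex.ofReal_zero Complex.ofReal_one, Matrix.toLin'_one]
    rfl
  map_mul' R S := by
    have h : ((R * S : Matrix.specialOrthogonalGroup (Fin N) ℝ) : Matrix (Fin N) (Fin N) ℝ) =
      (R : Matrix (Fin N) (Fin N) ℝ) * (S : Matrix (Fin N) (Fin N) ℝ) := rfl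
    have h' := Matrix.map_mul (f := Complex.ofRealHom) (L := (R : Matrix (Fin N) (Fin N) ℝ))
      (M := (S : Matrix (Fin N) (Fin N) ℝ))
    have h'' : ((R : Matrix (Fin N) (Fin N) ℝ) * (S : Matrix (Fin N) (Fin N) ℝ)).map
        Complex.ofReal = (R : Matrix (Fin N) (Fin N) ℝ).map Complex.ofReal *
          (S : Matrix (Fin N) (Fin N) ℝ).map Complex.ofReal := h'
    rw [h, h'', Matrix.toLin'_mul]
    rfl

/-- The summands of the decomposition: `H_i` for `0 ≤ i ≤ 2n`, `i ≠ n`, and `H_{n,1}`, `H_{n,2}`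
(labelled by the signs `1` and `-1`). -/
abbrev IrrepLabel (n : ℕ) : Type := {i : Fin (2 * n + 1) // (i : ℕ) ≠ n} ⊕ ℤˣ

end

/-! Conjugation by a matchgate preserves the real span of the Majorana operators. On two
neighbouring qubits the four Majorana operators of the pair exchange the even and the odd block.
Their off-diagonal blocks `X, Y, Z, -i` are a real basis of `i` times the quaternions, on which
`G(A, B)` acts by `w ↦ A w B†`, the classical map `SU(2) × SU(2) → SO(4)`. All other Majorana
operators restrict to `1 ⊗ 1` or `Z ⊗ Z` on the pair and are fixed. The trace form makes the
resulting real matrix orthogonal. The product `Γ` of all Majorana operators is a multiple of `Z ⊗ ⋯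
⊗ Z`, hence fixed, so the determinant is `1`. Conjugation is an algebra automorphism, so
antisymmetrized products turn this rotation into the exterior powers.

Right multiplication by `Γ` commutes with the group and sends each monomial of `S` to a sign times
that of `Sᶜ`; with the sign corrected it is the Hodge star. Scaled by `i^n` in degree `n` it becomes
an involution, the chirality, whose eigenspaces are the two half spaces.

Irreducibility needs only a subgroup of signed permutations. Quarter turns in the planes of adjacent
Majorana operators generate, up to signs, all permutations, so monomials of equal degree are
connected (`exists_naturalRep_majoranaKet_eq`). Their squares negate two adjacent Majorana operators
and act diagonally on monomials; the joint eigenvalues separate all monomials except those of `S`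
and `Sᶜ` (`eq_or_eq_compl_of_pairSign`). Thus each vector of an invariant subspace contributes
components `x|S⟩⟩ + y|Sᶜ⟩⟩` to it (`component_mem`). Outside degree `n` one of the two terms
vanishes, and in a half space the component is a multiple of one spanning vector.

An equivalence respects the same joint eigenspaces, so isomorphic summands have equal or
complementary degrees. The halves are told apart by a group element exchanging `|S⟩⟩` and `|Sᶜ⟩⟩` up
to scalars, since it acts on the corresponding vector of each half by a scalar proportional to `ε`.
Reality comes from the operator adjoint, an equivariant conjugate-linear involution that commutes
with chirality up to the factor `(-1)^n` from conjugating `i^n`. -/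

open scoped Kronecker Matrix

noncomputable section

/-! ### Ordered products of anticommuting elements. -/

section AnticommutingProducts

variable {A : Type*} [Ring A]

theorem prod_ofFn_comp_swap {k : ℕ} (v : Fin (k + 1) → A)
    (hv : Pairwise fun i j => v i * v j = -(v j * v i)) (i : Fin k) :
    (List.ofFn (v ∘ Equiv.swap i.castSucc i.succ)).prod = -(List.ofFn v).prod := by
  induction k with
  | zero => exact i.elim0
  | succ k ih =>
    induction i using Fin.cases with
    | zero =>
      have h : ∀ j : Fin k, Equiv.swap (Fin.castSucc (0 : Fin (k + 1))) (Fin.succ 0) j.succ.succ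
          = j.succ.succ := fun j =>
        Equiv.swap_apply_of_ne_of_ne (by simp [Fin.ext_iff]) (by simp [Fin.ext_iff])
      have h01 := hv (show (0 : Fin (k + 2)) ≠ 1 by simp)
      simp only [List.ofFn_succ, List.prod_cons, Function.comp_apply, h, ← mul_assoc]
      simp only [Fin.castSucc_zero, Equiv.swap_apply_left, Equiv.swap_apply_right]
      rw [show (Fin.succ 0 : Fin (k + 2)) = 1 from rfl, h01]
      simp [neg_mul]
    | succ i =>
      have h0 : Equiv.swap i.succ.castSucc i.succ.succ 0 = 0 :=
        Equiv.swap_apply_of_ne_of_ne (by simp [Fin.ext_iff]) (by simp [Fin.ext_iff])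
      have hs : ∀ j : Fin (k + 1), Equiv.swap i.succ.castSucc i.succ.succ j.succ
          = (Equiv.swap i.castSucc i.succ j).succ := by
        intro j
        rw [← Fin.succ_castSucc, (Fin.succ_injective _).swap_apply]
      have := ih (fun j => v j.succ) (fun a b hab => hv (by simpa using hab)) i
      rw [List.ofFn_succ, List.ofFn_succ (f := v), List.prod_cons, List.prod_cons]
      simp only [Function.comp_apply, h0, hs]
      simp only [Function.comp_def] at this
      rw [this, mul_neg]

/-- Adjacent transpositions generate the symmetric group and each costs one sign. The family `v`
stays general in the induction because a permuted anticommuting family is again anticommuting. -/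
theorem prod_ofFn_comp_perm {k : ℕ} (v : Fin k → A)
    (hv : Pairwise fun i j => v i * v j = -(v j * v i)) (σ : Equiv.Perm (Fin k)) :
    (List.ofFn (v ∘ σ)).prod = Equiv.Perm.sign σ • (List.ofFn v).prod := by
  cases k with
  | zero => simp [Subsingleton.elim σ 1]
  | succ k =>
    have hσ : σ ∈ Submonoid.closure (Set.range fun i : Fin k => Equiv.swap i.castSucc i.succ) := by
      rw [Equiv.Perm.mclosure_swap_castSucc_succ]; trivial
    induction hσ using Submonoid.closure_induction generalizing v with
    | mem x hx =>
      obtain ⟨i, rfl⟩ := hx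
      simp only
      rw [prod_ofFn_comp_swap v hv, Equiv.Perm.sign_swap (by simp [Fin.ext_iff])]
      simp
    | one => simp
    | mul x y _ _ hx hy =>
      have := hy (v ∘ x) (fun a b hab => hv (x.injective.ne hab))
      rw [Equiv.Perm.coe_mul, ← Function.comp_assoc, this, hx v hv, smul_smul, map_mul, mul_comm]

/-- The product of the `c a`, `a ∈ S`, in increasing order. -/
def orderedProd {N : ℕ} (c : Fin N → A) (S : Finset (Fin N)) : A :=
  ((S.sort (· ≤ ·)).map c).prod

theorem orderedProd_eq_prod_ofFn {N k : ℕ} (c : Fin N → A) {S : Finset (Fin N)} (h : S.card = k) :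
    orderedProd c S = (List.ofFn (c ∘ S.orderEmbOfFin h)).prod := by
  rw [orderedProd, ← Finset.listMap_orderEmbOfFin_finRange S h, List.map_map, ← List.ofFn_eq_map]

@[simp] theorem orderedProd_singleton {N : ℕ} (c : Fin N → A) (a : Fin N) :
    orderedProd c {a} = c a := by
  simp [orderedProd]

theorem orderedProd_smul {N : ℕ} (c : Fin N → A) (s : Fin N → ℤˣ) (S : Finset (Fin N)) :
    orderedProd (fun a => s a • c a) S = (∏ a ∈ S, s a) • orderedProd c S := by
  have hl : ∀ l : List (Fin N), (l.map fun a => s a • c a).prod =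
      (l.map s).prod • (l.map c).prod := by
    intro l
    induction l with
    | nil => simp
    | cons a l ih => simp [ih, smul_smul, smul_mul_assoc, mul_smul_comm, mul_comm]
  rw [orderedProd, hl]
  congr 1
  conv_rhs => rw [← Finset.sort_toFinset (s := S) (r := (· ≤ ·))]
  rw [List.prod_toFinset _ (Finset.sort_nodup _ _)]

variable {N : ℕ} {c : Fin N → A} (hc : Pairwise fun i j => c i * c j = -(c j * c i))
include hc

/-- Writing the factors of `S` before those of its complement rearranges the full product by the
inverse of the permutation that defines `complementSign`, and a permutation and its inverse have the
same sign. -/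
theorem orderedProd_univ_eq (S : Finset (Fin N)) :
    orderedProd c Finset.univ = complementSign S • (orderedProd c S * orderedProd c Sᶜ) := by
  have hN : S.card + Sᶜ.card = N := by simp
  set π : Equiv.Perm (Fin N) := (finSumEquivOfFinset (s := S) rfl rfl).symm.trans
      (finSumFinEquiv.trans (finCongr (by simp : S.card + Sᶜ.card = N))) with hπ
  have key : (List.ofFn (c ∘ π.symm)).prod = orderedProd c S * orderedProd c Sᶜ := by
    rw [orderedProd_eq_prod_ofFn c (S := S) rfl, orderedProd_eq_prod_ofFn c (S := Sᶜ) rfl,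
      ← List.prod_append, ← List.ofFn_fin_append, List.ofFn_congr hN.symm]
    congr 2
    funext j
    obtain ⟨j | j, rfl⟩ := finSumFinEquiv.surjective j <;>
    simp [hπ]
  have hu : orderedProd c Finset.univ = (List.ofFn c).prod := by
    rw [orderedProd, Fin.sort_univ, List.ofFn_eq_map]
  rw [← key, prod_ofFn_comp_perm c hc, ← hu, smul_smul, Equiv.Perm.sign_symm]
  rw [complementSign, ← hπ, Int.units_mul_self, one_smul]

theorem prod_ofFn_comp_injective {k : ℕ} {f : Fin k → Fin N} (hf : Function.Injective f) :
    ∃ s : ℤˣ, (List.ofFn (c ∘ f)).prod = s • orderedProd c (Finset.univ.image f) := by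
  have hk : (Finset.univ.image f).card = k := by
    rw [Finset.card_image_of_injective _ hf]; simp
  have hmem : ∀ j, f j ∈ Finset.univ.image f := fun j => by simp
  let g : Fin k → Fin k := fun j => ((Finset.univ.image f).orderIsoOfFin hk).symm ⟨f j, hmem j⟩
  have hg : Function.Injective g := fun a b hab => hf (by simpa [g] using hab)
  let σ : Equiv.Perm (Fin k) := Equiv.ofBijective g (Finite.injective_iff_bijective.1 hg)
  have hσ : f = (Finset.univ.image f).orderEmbOfFin hk ∘ σ := by
    funext j
    simp [σ, g, ← Finset.coe_orderIsoOfFin_apply]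
  refine ⟨Equiv.Perm.sign σ, ?_⟩
  rw [orderedProd_eq_prod_ofFn c hk, ← prod_ofFn_comp_perm (c ∘ _)
    (fun a b hab => hc (((Finset.univ.image f).orderEmbOfFin hk).injective.ne hab))]
  conv_lhs => rw [hσ]
  rfl

/-- The permuted factors are distinct, so sorting them costs only a sign; its value never matters
later. -/
theorem orderedProd_smul_comp_perm (s : Fin N → ℤˣ) (π : Equiv.Perm (Fin N)) (S : Finset (Fin N)) :
    ∃ t : ℤˣ, orderedProd (fun a => s a • c (π a)) S = t • orderedProd c (S.image π) := by
  obtain ⟨t, ht⟩ := prod_ofFn_comp_injective hc (f := π ∘ S.orderEmbOfFin rfl)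
    (π.injective.comp (S.orderEmbOfFin rfl).injective)
  have him : Finset.univ.image (π ∘ S.orderEmbOfFin rfl) = S.image π := by
    ext x
    simp only [Finset.mem_image, Finset.mem_univ, true_and, Function.comp_apply]
    constructor
    · rintro ⟨a, rfl⟩; exact ⟨_, Finset.orderEmbOfFin_mem _ _ _, rfl⟩
    · rintro ⟨a, ha, rfl⟩
      obtain ⟨b, hb⟩ : a ∈ Set.range (S.orderEmbOfFin rfl) := by simpa using ha
      exact ⟨b, by rw [hb]⟩
  refine ⟨(∏ a ∈ S, s a) * t, ?_⟩
  rw [orderedProd_smul (fun a => c (π a)), ← him, mul_smul, ← ht]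
  congr 1
  exact orderedProd_eq_prod_ofFn (c ∘ π) rfl

variable (hc1 : ∀ a, c a * c a = 1)
include hc1

/-- Moving `c a` through the product picks up `-1` at every factor except `c a` itself. -/
theorem mul_orderedProd_mul (a : Fin N) (S : Finset (Fin N)) :
    c a * orderedProd c S * c a = (∏ b ∈ S, if b = a then (1 : ℤˣ) else -1) • orderedProd c S := by
  have hl : ∀ l : List (Fin N), c a * (l.map c).prod * c a =
      (l.map fun b => if b = a then (1 : ℤˣ) else -1).prod • (l.map c).prod := by
    intro l
    induction l with
    | nil => simp [hc1]
    | cons b l ih =>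
      simp only [List.map_cons, List.prod_cons]
      have : c a * c b = (if b = a then (1 : ℤˣ) else -1) • (c b * c a) := by
        split_ifs with h
        · rw [h]; simp
        · rw [hc (Ne.symm h)]; simp
      rw [← mul_assoc, this, smul_mul_assoc, smul_mul_assoc, mul_assoc, mul_assoc, ← mul_assoc (c a), ih,
        mul_smul_comm, smul_smul]
  rw [orderedProd, hl]
  congr 1
  conv_rhs => rw [← Finset.sort_toFinset (s := S) (r := (· ≤ ·))]
  rw [List.prod_toFinset _ (Finset.sort_nodup _ _)]

/-- The reversed product is the inverse, because the `c a` square to `1`, and reversing the order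
costs the sign of the reversal. That sign is never evaluated: it only has to depend on the degree
alone. -/
theorem orderedProd_mul_self (S : Finset (Fin N)) :
    orderedProd c S * orderedProd c S = Equiv.Perm.sign (Fin.revPerm (n := S.card)) • 1 := by
  have hr : ∀ l : List (Fin N), (l.reverse.map c).prod * (l.map c).prod = 1 := by
    intro l
    induction l with
    | nil => simp
    | cons b l ih =>
      simp only [List.reverse_cons, List.map_append, List.prod_append, List.map_cons, List.prod_cons,
        List.map_nil, List.prod_nil, mul_one]
      rw [mul_assoc, ← mul_assoc (c b), hc1, one_mul, ih]
  have h1 := prod_ofFn_comp_perm (c ∘ S.orderEmbOfFin rfl)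
    (fun a b hab => hc ((S.orderEmbOfFin rfl).injective.ne hab)) Fin.revPerm
  have h2 : (List.ofFn ((c ∘ S.orderEmbOfFin rfl) ∘ Fin.revPerm)).prod
      = ((S.sort (· ≤ ·)).reverse.map c).prod := by
    rw [← Finset.listMap_orderEmbOfFin_finRange S rfl, ← List.map_reverse, List.map_map,
      List.finRange_reverse, List.map_map, List.ofFn_eq_map]
    rfl
  have h3 := hr (S.sort (· ≤ ·))
  rw [← h2, h1, ← orderedProd_eq_prod_ofFn, smul_mul_assoc] at h3
  rw [← h3, smul_smul, Int.units_mul_self, one_smul]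
  rfl

end AnticommutingProducts

/-! ### Tensor products of one-qubit operators and two-qubit gates. -/

section TensorOperators

variable {n : ℕ}

theorem tensorOp_mul (P Q : Fin n → Matrix (Fin 2) (Fin 2) ℂ) :
    tensorOp P * tensorOp Q = tensorOp fun j => P j * Q j := by
  ext x y
  simp only [tensorOp, Matrix.mul_apply, Matrix.of_apply, ← Finset.prod_mul_distrib]
  rw [Fintype.prod_sum]

theorem tensorOp_smul (s : Fin n → ℂ) (P : Fin n → Matrix (Fin 2) (Fin 2) ℂ) :
    tensorOp (fun j => s j • P j) = (∏ j, s j) • tensorOp P := by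
  ext x y
  simp [tensorOp, Finset.prod_mul_distrib]

@[simp] theorem tensorOp_one : tensorOp (fun _ : Fin n => 1) = 1 := by
  ext x y
  simp only [tensorOp, Matrix.of_apply, Matrix.one_apply, funext_iff]
  split_ifs with h
  · exact Finset.prod_eq_one fun j _ => by simp [h j]
  · obtain ⟨j, hj⟩ := not_forall.1 h
    exact Finset.prod_eq_zero (Finset.mem_univ j) (by simp [hj])

theorem tensorOp_conjTranspose (P : Fin n → Matrix (Fin 2) (Fin 2) ℂ) :
    (tensorOp P)ᴴ = tensorOp fun j => (P j)ᴴ := by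
  ext x y
  simp [tensorOp, Matrix.conjTranspose_apply]

theorem tensorOp_mul_comm_of_smul {s : Fin n → ℂ} {P Q : Fin n → Matrix (Fin 2) (Fin 2) ℂ}
    (h : ∀ j, P j * Q j = s j • (Q j * P j)) :
    tensorOp P * tensorOp Q = (∏ j, s j) • (tensorOp Q * tensorOp P) := by
  simp only [tensorOp_mul, h, tensorOp_smul]

theorem prod_eq_prod_compl_pair {k k' : Fin n} (hk : k ≠ k') (f : Fin n → ℂ) :
    ∏ j, f j = (∏ j ∈ ({k, k'} : Finset (Fin n))ᶜ, f j) * (f k * f k') := by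
  rw [← Finset.prod_pair hk, Finset.prod_compl_mul_prod]

/-- In the matrix product only those intermediate bit strings contribute that agree with `x` off the
two qubits, which leaves a sum over four terms. -/
theorem onQubits_mul_tensorOp_apply {k k' : Fin n} (hk : k ≠ k')
    (M : Matrix (Fin 2 × Fin 2) (Fin 2 × Fin 2) ℂ) (P : Fin n → Matrix (Fin 2) (Fin 2) ℂ)
    (x y : Fin n → Fin 2) :
    (onQubits k k' M * tensorOp P) x y = (∏ j ∈ ({k, k'} : Finset (Fin n))ᶜ, P j (x j) (y j)) *
      (M * (P k ⊗ₖ P k')) (x k, x k') (y k, y k') := by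
  rw [Matrix.mul_apply, Matrix.mul_apply, Finset.mul_sum]
  symm
  refine Finset.sum_of_injOn
    (fun p : Fin 2 × Fin 2 => Function.update (Function.update x k p.1) k' p.2) ?_ ?_ ?_ ?_
  · intro p _ q _ h
    have h1 := congrFun h k
    have h2 := congrFun h k'
    simp [hk] at h1 h2
    exact Prod.ext h1 h2
  · simp
  · intro z _ hz
    rw [onQubits, Matrix.of_apply, if_neg, zero_mul]
    intro h
    refine hz ⟨(z k, z k'), by simp, ?_⟩
    funext j
    by_cases h1 : j = k'
    · subst h1; simp
    · by_cases h2 : j = k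
      · subst h2; simp [h1]
      · simp [h1, h2, h j h2 h1]
  · intro p _
    have h1 : ∀ j, j ≠ k → j ≠ k' →
        x j = Function.update (Function.update x k p.1) k' p.2 j := by
      intro j h1 h2; simp [h1, h2]
    rw [onQubits, Matrix.of_apply, if_pos h1, tensorOp, Matrix.of_apply,
      prod_eq_prod_compl_pair hk]
    have h2 : ∏ j ∈ ({k, k'} : Finset (Fin n))ᶜ,
        P j (Function.update (Function.update x k p.1) k' p.2 j) (y j)
        = ∏ j ∈ ({k, k'} : Finset (Fin n))ᶜ, P j (x j) (y j) := by
      refine Finset.prod_congr rfl fun j hj => ?_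
      simp only [Finset.mem_compl, Finset.mem_insert, Finset.mem_singleton, not_or] at hj
      rw [← h1 j hj.1 hj.2]
    rw [h2]
    simp [hk, Matrix.kroneckerMap_apply]
    ring

theorem tensorOp_mul_onQubits_apply {k k' : Fin n} (hk : k ≠ k')
    (M : Matrix (Fin 2 × Fin 2) (Fin 2 × Fin 2) ℂ) (P : Fin n → Matrix (Fin 2) (Fin 2) ℂ)
    (x y : Fin n → Fin 2) :
    (tensorOp P * onQubits k k' M) x y = (∏ j ∈ ({k, k'} : Finset (Fin n))ᶜ, P j (x j) (y j)) *
      ((P k ⊗ₖ P k') * M) (x k, x k') (y k, y k') := by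
  -- Transposition exchanges the two orders of multiplication and reduces to the previous lemma.
  have h : (onQubits k k' Mᵀ * tensorOp fun j => (P j)ᵀ) = (tensorOp P * onQubits k k' M)ᵀ := by
    rw [Matrix.transpose_mul]
    congr 1
    ext x y
    simp [onQubits, Matrix.transpose_apply, eq_comm]
  have h' := onQubits_mul_tensorOp_apply hk Mᵀ (fun j => (P j)ᵀ) y x
  rw [h, show (P k)ᵀ ⊗ₖ (P k')ᵀ = (P k ⊗ₖ P k')ᵀ from Matrix.kroneckerMap_transpose _ _ _,
    ← Matrix.transpose_mul] at h'
  simpa only [Matrix.transpose_apply] using h'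

/-- Reduces a conjugation rule on `n` qubits to a `4 × 4` identity, provided the operators agree on
the spectator qubits. The coefficients are real because they become entries of a real rotation. -/
theorem onQubits_mul_tensorOp_eq_sum {ι : Type*} [Fintype ι] {k k' : Fin n} (hk : k ≠ k')
    {M : Matrix (Fin 2 × Fin 2) (Fin 2 × Fin 2) ℂ} {Q : Fin n → Matrix (Fin 2) (Fin 2) ℂ}
    {P : ι → Fin n → Matrix (Fin 2) (Fin 2) ℂ} {r : ι → ℝ}
    (hP : ∀ i j, j ≠ k → j ≠ k' → P i j = Q j)
    (h : M * (Q k ⊗ₖ Q k') = ∑ i, r i • ((P i k ⊗ₖ P i k') * M)) :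
    onQubits k k' M * tensorOp Q = ∑ i, r i • (tensorOp (P i) * onQubits k k' M) := by
  ext x y
  rw [onQubits_mul_tensorOp_apply hk, h]
  simp only [Matrix.sum_apply, Matrix.smul_apply, tensorOp_mul_onQubits_apply hk, Finset.mul_sum]
  refine Finset.sum_congr rfl fun i _ => ?_
  rw [mul_smul_comm]
  congr 2
  refine Finset.prod_congr rfl fun j hj => ?_
  simp only [Finset.mem_compl, Finset.mem_insert, Finset.mem_singleton, not_or] at hj
  rw [hP i j hj.1 hj.2]

theorem onQubits_mul_tensorOp_comm {k k' : Fin n} (hk : k ≠ k')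
    {M : Matrix (Fin 2 × Fin 2) (Fin 2 × Fin 2) ℂ} {Q : Fin n → Matrix (Fin 2) (Fin 2) ℂ}
    (h : M * (Q k ⊗ₖ Q k') = (Q k ⊗ₖ Q k') * M) :
    onQubits k k' M * tensorOp Q = tensorOp Q * onQubits k k' M := by
  ext x y
  rw [onQubits_mul_tensorOp_apply hk, h, tensorOp_mul_onQubits_apply hk]

end TensorOperators

/-! ### The Clifford relations of the Majorana operators. -/

section Majorana

variable {n : ℕ}

theorem pauliX_mul_self : pauliX * pauliX = 1 := by
  ext i j; fin_cases i <;> fin_cases j <;> simp [pauliX]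
theorem pauliY_mul_self : pauliY * pauliY = 1 := by
  ext i j; fin_cases i <;> fin_cases j <;> simp [pauliY]
theorem pauliZ_mul_self : pauliZ * pauliZ = 1 := by
  ext i j; fin_cases i <;> fin_cases j <;> simp [pauliZ]
theorem pauliX_mul_pauliY : pauliX * pauliY = Complex.I • pauliZ := by
  ext i j; fin_cases i <;> fin_cases j <;> simp [pauliX, pauliY, pauliZ]
theorem pauliY_mul_pauliX : pauliY * pauliX = -(Complex.I • pauliZ) := by
  ext i j; fin_cases i <;> fin_cases j <;> simp [pauliX, pauliY, pauliZ]
theorem pauliX_mul_pauliZ : pauliX * pauliZ = -(pauliZ * pauliX) := by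
  ext i j; fin_cases i <;> fin_cases j <;> simp [pauliX, pauliZ]
theorem pauliY_mul_pauliZ : pauliY * pauliZ = -(pauliZ * pauliY) := by
  ext i j; fin_cases i <;> fin_cases j <;> simp [pauliY, pauliZ]
theorem pauliX_conjTranspose : pauliXᴴ = pauliX := by
  ext i j; fin_cases i <;> fin_cases j <;> simp [pauliX]
theorem pauliY_conjTranspose : pauliYᴴ = pauliY := by
  ext i j; fin_cases i <;> fin_cases j <;> simp [pauliY]
theorem pauliZ_conjTranspose : pauliZᴴ = pauliZ := by
  ext i j; fin_cases i <;> fin_cases j <;> simp [pauliZ]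

/-- The one-qubit factors of a Majorana operator. -/
def majoranaFactor (m j : ℕ) : Matrix (Fin 2) (Fin 2) ℂ :=
  if j < m / 2 then pauliZ else if j = m / 2 then (if Even m then pauliX else pauliY) else 1

theorem majorana_eq_tensorOp (m : Fin (2 * n)) :
    majorana m = tensorOp fun j : Fin n => majoranaFactor m j := rfl

theorem majoranaFactor_mul_self (m j : ℕ) : majoranaFactor m j * majoranaFactor m j = 1 := by
  unfold majoranaFactor
  split_ifs <;> simp [pauliX_mul_self, pauliY_mul_self, pauliZ_mul_self]

theorem majorana_mul_self (m : Fin (2 * n)) : majorana m * majorana m = 1 := by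
  rw [majorana_eq_tensorOp, tensorOp_mul]
  simp [majoranaFactor_mul_self]

theorem majorana_conjTranspose (m : Fin (2 * n)) : (majorana m)ᴴ = majorana m := by
  rw [majorana_eq_tensorOp, tensorOp_conjTranspose]
  congr 1
  funext j
  unfold majoranaFactor
  split_ifs <;> simp [pauliX_conjTranspose, pauliY_conjTranspose, pauliZ_conjTranspose]

/-- Left of qubit `m / 2` both factors are `Z`, and right of it the first is `1`. On that qubit
alone `X` or `Y` meets an anticommuting Pauli matrix, so the tensor products anticommute through
exactly one sign. -/
theorem majoranaFactor_mul_comm {m m' : ℕ} (h : m < m') (j : ℕ) :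
    majoranaFactor m j * majoranaFactor m' j =
      (if j = m / 2 then (-1 : ℂ) else 1) • (majoranaFactor m' j * majoranaFactor m j) := by
  have hle : m / 2 ≤ m' / 2 := Nat.div_le_div_right h.le
  rcases lt_trichotomy j (m / 2) with hj | hj | hj
  · simp [majoranaFactor, hj, hj.ne, hj.trans_le hle]
  · subst hj
    rcases hle.lt_or_eq with h' | h'
    · by_cases he : Even m <;>
        simp [majoranaFactor, h', he, pauliX_mul_pauliZ, pauliY_mul_pauliZ]
    · have he : Even m := by rw [Nat.even_iff]; omega
      have ho : ¬ Even m' := by rw [Nat.even_iff]; omega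
      simp [majoranaFactor, ← h', he, ho, pauliX_mul_pauliY, pauliY_mul_pauliX]
  · have : majoranaFactor m j = 1 := by simp [majoranaFactor, hj.not_gt, hj.ne']
    simp [this, hj.ne']

theorem majorana_anticomm :
    Pairwise fun a b : Fin (2 * n) => (majorana a : QubitOp n) * majorana b =
      -(majorana b * majorana a) := by
  have key : ∀ a b : Fin (2 * n), a < b →
      (majorana a : QubitOp n) * majorana b = -(majorana b * majorana a) := by
    intro a b hab
    rw [majorana_eq_tensorOp, majorana_eq_tensorOp, tensorOp_mul_comm_of_smul
      (s := fun j => if (j : ℕ) = (a : ℕ) / 2 then -1 else 1)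
      (fun j => majoranaFactor_mul_comm hab j)]
    have : ∏ j : Fin n, (if (j : ℕ) = (a : ℕ) / 2 then (-1 : ℂ) else 1) = -1 := by
      rw [Finset.prod_eq_single (⟨a / 2, by omega⟩ : Fin n)]
      · simp
      · intro b _ hb
        rw [if_neg fun h => hb (Fin.ext h)]
      · simp
    rw [this, neg_one_smul]
  intro a b hab
  rcases lt_or_gt_of_ne hab with h | h
  · exact key a b h
  · simp only [key b a h, neg_neg]

/-- The product of all Majorana operators. -/
theorem orderedProd_majorana_univ :
    orderedProd (majorana (n := n)) Finset.univ = tensorOp fun _ => Complex.I • pauliZ := by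
  -- Induction on the number of qubits covered: in the next two Majorana operators the `Z`-strings
  -- cancel and `X Y = i Z` remains on qubit `m`.
  have h : ∀ m : ℕ, m ≤ n →
      ((List.range (2 * m)).map fun a => (tensorOp fun j : Fin n => majoranaFactor a j)).prod =
        tensorOp fun j : Fin n => if (j : ℕ) < m then Complex.I • pauliZ else 1 := by
    intro m hm
    induction m with
    | zero => simp
    | succ m ih =>
      rw [mul_add, mul_one, List.range_succ, List.range_succ, List.map_append, List.map_append,
        List.prod_append, List.prod_append, ih (by omega)]
      simp only [List.map_cons, List.map_nil, List.prod_cons, List.prod_nil, mul_one, tensorOp_mul]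
      congr 1
      funext j
      have h1 : (2 * m) / 2 = m := by omega
      have h2 : (2 * m + 1) / 2 = m := by omega
      have h3 : ¬ Even (2 * m + 1) := by simp
      rcases lt_trichotomy (j : ℕ) m with hj | hj | hj
      · simp [majoranaFactor, h1, h2, hj, hj.trans (Nat.lt_succ_self m), pauliZ_mul_self]
      · simp [majoranaFactor, h1, h2, h3, hj, pauliX_mul_pauliY]
      · simp [majoranaFactor, h1, h2, hj.not_gt, hj.ne', show ¬ (j : ℕ) < m + 1 by omega]
  have := h n le_rfl
  rw [orderedProd, Fin.sort_univ]
  rw [← List.map_coe_finRange_eq_range, List.map_map] at this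
  simpa [Function.comp_def, ← majorana_eq_tensorOp] using this

end Majorana

/-! ### Conjugation of Majorana operators by a single matchgate. -/

section Generators

/-- The two-qubit operator that takes the odd block to the even one by `u` and the even block to
the odd one by `v`, in the conventions of `matchgate`. -/
def offDiagonalGate (u v : Matrix (Fin 2) (Fin 2) ℂ) : Matrix (Fin 2 × Fin 2) (Fin 2 × Fin 2) ℂ :=
  Matrix.of fun p q =>
    if p.1 = p.2 ∧ q.1 ≠ q.2 then u p.1 q.1
    else if p.1 ≠ p.2 ∧ q.1 = q.2 then v p.1 q.1
    else 0

theorem matchgate_mul_offDiagonalGate (A B u v : Matrix (Fin 2) (Fin 2) ℂ) :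
    matchgate A B * offDiagonalGate u v = offDiagonalGate (A * u) (B * v) := by
  simp only [← Matrix.ext_iff, Prod.forall, Fin.forall_fin_two]
  simp [matchgate, offDiagonalGate, Matrix.mul_apply, Fintype.sum_prod_type]

theorem offDiagonalGate_mul_matchgate (A B u v : Matrix (Fin 2) (Fin 2) ℂ) :
    offDiagonalGate u v * matchgate A B = offDiagonalGate (u * B) (v * A) := by
  simp only [← Matrix.ext_iff, Prod.forall, Fin.forall_fin_two]
  simp [matchgate, offDiagonalGate, Matrix.mul_apply, Fintype.sum_prod_type]

theorem matchgate_mul_matchgate (A B A' B' : Matrix (Fin 2) (Fin 2) ℂ) :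
    matchgate A B * matchgate A' B' = matchgate (A * A') (B * B') := by
  simp only [← Matrix.ext_iff, Prod.forall, Fin.forall_fin_two]
  simp [matchgate, Matrix.mul_apply, Fintype.sum_prod_type]

theorem matchgate_conjTranspose (A B : Matrix (Fin 2) (Fin 2) ℂ) :
    (matchgate A B)ᴴ = matchgate Aᴴ Bᴴ := by
  simp only [← Matrix.ext_iff, Prod.forall, Fin.forall_fin_two]
  simp [matchgate, Matrix.conjTranspose_apply]

theorem matchgate_one : matchgate 1 1 = 1 := by
  simp only [← Matrix.ext_iff, Prod.forall, Fin.forall_fin_two]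
  simp [matchgate, Matrix.one_apply]

theorem pauliZ_kronecker_pauliZ : pauliZ ⊗ₖ pauliZ = matchgate 1 (-1) := by
  simp only [← Matrix.ext_iff, Prod.forall, Fin.forall_fin_two]
  simp [matchgate, pauliZ, Matrix.kroneckerMap_apply]

theorem matchgate_comm_pauliZ (A B : Matrix (Fin 2) (Fin 2) ℂ) :
    matchgate A B * (pauliZ ⊗ₖ pauliZ) = (pauliZ ⊗ₖ pauliZ) * matchgate A B := by
  simp [pauliZ_kronecker_pauliZ, matchgate_mul_matchgate]

/-- The upper right blocks of `X ⊗ 1`, `Y ⊗ 1`, `Z ⊗ X` and `Z ⊗ Y`. -/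
def localBlock : Fin 4 → Matrix (Fin 2) (Fin 2) ℂ :=
  ![pauliX, pauliY, pauliZ, -(Complex.I • 1)]

theorem localBlock_zero : localBlock 0 = pauliX := rfl
theorem localBlock_one : localBlock 1 = pauliY := rfl
theorem localBlock_two : localBlock 2 = pauliZ := rfl
theorem localBlock_three : localBlock 3 = -(Complex.I • 1) := rfl

/-- Each of these operators flips exactly one of the two bits, so it exchanges the parity blocks;
being Hermitian, it is determined by its upper right block. -/
theorem majoranaFactor_kronecker (k : ℕ) (j : Fin 4) :
    majoranaFactor (2 * k + j) k ⊗ₖ majoranaFactor (2 * k + j) (k + 1) =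
      offDiagonalGate (localBlock j) (localBlock j)ᴴ := by
  have h0 : (2 * k) / 2 = k := by omega
  have h2 : (2 * k + 1) / 2 = k := by omega
  have h3 : (2 * k + 2) / 2 = k + 1 := by omega
  have h4 : (2 * k + 3) / 2 = k + 1 := by omega
  have h5 : Even (2 * k + 2) := by simp [Nat.even_add]
  have h6 : ¬ Even (2 * k + 3) := by simp [Nat.even_add]; decide
  simp only [← Matrix.ext_iff, Prod.forall, Fin.forall_fin_two]
  fin_cases j
  · simp [majoranaFactor, h0, offDiagonalGate, localBlock_zero, pauliX,
      Matrix.kroneckerMap_apply, Matrix.conjTranspose_apply]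
  · simp [majoranaFactor, h2, offDiagonalGate, localBlock_one, pauliY,
      Matrix.kroneckerMap_apply, Matrix.conjTranspose_apply]
  · simp [majoranaFactor, h3, h5, offDiagonalGate, localBlock_two, pauliX, pauliZ,
      Matrix.kroneckerMap_apply, Matrix.conjTranspose_apply]
  · simp [majoranaFactor, h4, h6, offDiagonalGate, localBlock_three, pauliY, pauliZ,
      Matrix.kroneckerMap_apply, Matrix.conjTranspose_apply]

/-- The two conditions say that `w` is `i` times a quaternion, where the quaternions are the real
span of `SU(2)`. -/
theorem localBlock_expansion {w : Matrix (Fin 2) (Fin 2) ℂ} (h0 : w 1 1 = -star (w 0 0))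
    (h1 : w 1 0 = star (w 0 1)) : ∃ r : Fin 4 → ℝ, w = ∑ i, r i • localBlock i := by
  refine ⟨![(w 0 1).re, -(w 0 1).im, (w 0 0).re, -(w 0 0).im], ?_⟩
  ext i j
  fin_cases i <;> fin_cases j <;>
    simp [Fin.sum_univ_four, localBlock_zero, localBlock_one, localBlock_two, localBlock_three, pauliX, pauliY, pauliZ, h0, h1, Complex.ext_iff]

theorem localBlock_symm (j : Fin 4) :
    localBlock j 1 1 = -star (localBlock j 0 0) ∧ localBlock j 1 0 = star (localBlock j 0 1) := by
  fin_cases j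
  · simp [localBlock_zero, pauliX]
  · simp [localBlock_one, pauliY]
  · simp [localBlock_two, pauliZ]
  · simp [localBlock_three]

theorem entries_of_mem_specialUnitaryGroup {A : Matrix (Fin 2) (Fin 2) ℂ}
    (hA : A ∈ Matrix.specialUnitaryGroup (Fin 2) ℂ) :
    A 1 1 = star (A 0 0) ∧ A 1 0 = -star (A 0 1) := by
  obtain ⟨hu, hd⟩ := Matrix.mem_specialUnitaryGroup_iff.1 hA
  have h1 : Aᴴ = A.adjugate := by
    have h2 : Aᴴ * A = 1 := (Matrix.mem_unitaryGroup_iff').1 hu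
    have h3 : A * A.adjugate = 1 := by rw [Matrix.mul_adjugate, hd, one_smul]
    rw [← mul_one Aᴴ, ← h3, ← mul_assoc, h2, one_mul]
  rw [Matrix.adjugate_fin_two] at h1
  have h2 := congrFun₂ h1 0 0
  have h3 := congrFun₂ h1 1 0
  simp [Matrix.conjTranspose_apply] at h2 h3
  exact ⟨h2.symm, by simp [h3]⟩

/-- Quaternions are stable under multiplication by unit quaternions on both sides; this is the
action behind `SU(2) × SU(2) → SO(4)`. -/
theorem localBlock_conj {A B : Matrix (Fin 2) (Fin 2) ℂ}
    (hA : A ∈ Matrix.specialUnitaryGroup (Fin 2) ℂ)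
    (hB : B ∈ Matrix.specialUnitaryGroup (Fin 2) ℂ) (j : Fin 4) :
    ∃ r : Fin 4 → ℝ, A * localBlock j * Bᴴ = ∑ i, r i • localBlock i := by
  obtain ⟨a1, a2⟩ := entries_of_mem_specialUnitaryGroup hA
  obtain ⟨b1, b2⟩ := entries_of_mem_specialUnitaryGroup hB
  obtain ⟨q1, q2⟩ := localBlock_symm j
  refine localBlock_expansion ?_ ?_ <;>
  · simp [Matrix.mul_apply, Fin.sum_univ_two, Matrix.conjTranspose_apply, a1, a2, b1, b2, q1, q2]
    ring

variable {n : ℕ} {k k' : Fin n} (hk : (k' : ℕ) = k + 1)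
include hk

/-- On the pair of qubits such an operator is `1 ⊗ 1` or `Z ⊗ Z`, and the latter is a scalar on each
parity block. This is where the restriction to neighbouring qubits enters. -/
theorem onQubits_matchgate_comm_majorana (A B : Matrix (Fin 2) (Fin 2) ℂ) {l : Fin (2 * n)}
    (h : (l : ℕ) / 2 ≠ k) (h' : (l : ℕ) / 2 ≠ k') :
    onQubits k k' (matchgate A B) * majorana l = majorana l * onQubits k k' (matchgate A B) := by
  rw [majorana_eq_tensorOp]
  refine onQubits_mul_tensorOp_comm (fun h => by simp [h] at hk) ?_
  rcases lt_or_gt_of_ne h with h1 | h1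
  · have e1 : majoranaFactor l k = 1 := by simp [majoranaFactor, h1.not_gt, h1.ne']
    have h2 : (l : ℕ) / 2 < k' := by omega
    have e2 : majoranaFactor l k' = 1 := by simp [majoranaFactor, h2.not_gt, h2.ne']
    simp [e1, e2]
  · have e1 : majoranaFactor l k = pauliZ := by simp [majoranaFactor, h1]
    have h2 : (k' : ℕ) < (l : ℕ) / 2 := by omega
    have e2 : majoranaFactor l k' = pauliZ := by simp [majoranaFactor, h2]
    simp only [e1, e2]
    exact matchgate_comm_pauliZ A B

/-- The hypotheses are the two off-diagonal blocks of the claimed identity. Since `r` is real, the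
same coefficients serve both blocks. -/
theorem onQubits_matchgate_mul_majorana {A B : Matrix (Fin 2) (Fin 2) ℂ} {r : Fin 4 → ℝ} {j : Fin 4}
    (h : A * localBlock j = (∑ i, r i • localBlock i) * B)
    (h' : B * (localBlock j)ᴴ = (∑ i, r i • localBlock i)ᴴ * A) :
    onQubits k k' (matchgate A B) * majorana ⟨2 * k + j, by omega⟩ =
      ∑ i : Fin 4, r i • (majorana ⟨2 * k + i, by omega⟩ * onQubits k k' (matchgate A B)) := by
  simp only [majorana_eq_tensorOp]
  refine onQubits_mul_tensorOp_eq_sum (fun h => by simp [h] at hk) ?_ ?_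
  · intro i x hx hx'
    have hx : (x : ℕ) ≠ k := fun h => hx (Fin.ext h)
    have hx' : (x : ℕ) ≠ k' := fun h => hx' (Fin.ext h)
    rcases lt_or_ge (x : ℕ) k with h1 | h1
    · rw [majoranaFactor, majoranaFactor, if_pos (by omega), if_pos (by omega)]
    · rw [majoranaFactor, majoranaFactor, if_neg (by omega), if_neg (by omega),
        if_neg (by omega), if_neg (by omega)]
  · simp only [hk, majoranaFactor_kronecker, matchgate_mul_offDiagonalGate,
      offDiagonalGate_mul_matchgate, h, h']
    simp only [Finset.sum_mul, Matrix.conjTranspose_sum, Matrix.conjTranspose_smul, smul_mul_assoc]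
    ext ⟨a, b⟩ ⟨a', b'⟩
    simp only [Matrix.sum_apply, Matrix.smul_apply, offDiagonalGate, Matrix.of_apply]
    split_ifs <;> simp

/-- The full product is `i Z` on every qubit. Its invariance yields both determinant `1` and the
equivariance of the Hodge star. -/
theorem onQubits_matchgate_comm_parity (A B : Matrix (Fin 2) (Fin 2) ℂ) :
    onQubits k k' (matchgate A B) * orderedProd majorana Finset.univ =
      orderedProd majorana Finset.univ * onQubits k k' (matchgate A B) := by
  rw [orderedProd_majorana_univ]
  refine onQubits_mul_tensorOp_comm (fun h => by simp [h] at hk) ?_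
  simp only [Matrix.smul_kronecker, Matrix.kronecker_smul, mul_smul_comm, smul_mul_assoc,
    matchgate_comm_pauliZ]

end Generators

/-! ### Orthonormality of the Majorana monomials. -/

section Orthonormality

variable {n : ℕ}

theorem units_smul_eq {V : Type*} [AddCommGroup V] [Module ℂ V] (s : ℤˣ) (v : V) :
    s • v = ((s : ℤ) : ℂ) • v := by
  rw [Units.smul_def, Int.cast_smul_eq_zsmul]

theorem units_cast_mul_self (s : ℤˣ) : ((s : ℤ) : ℂ) * ((s : ℤ) : ℂ) = 1 := by
  rcases Int.units_eq_one_or s with rfl | rfl <;> simp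

theorem units_cast_ne_zero (s : ℤˣ) : ((s : ℤ) : ℂ) ≠ 0 := by
  rcases Int.units_eq_one_or s with rfl | rfl <;> simp

/-- The sign of the permutation that reverses `k` objects. -/
def revSign (k : ℕ) : ℤˣ := Equiv.Perm.sign (Fin.revPerm (n := k))

theorem majoranaProd_mul_self (S : Finset (Fin (2 * n))) :
    (orderedProd majorana S : QubitOp n) * orderedProd majorana S = revSign S.card • 1 :=
  orderedProd_mul_self majorana_anticomm majorana_mul_self S

theorem majoranaProd_conjTranspose_mul_self (S : Finset (Fin (2 * n))) :
    (orderedProd majorana S : QubitOp n)ᴴ * orderedProd majorana S = 1 := by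
  have hl : ∀ l : List (Fin (2 * n)),
      ((l.map majorana).prod : QubitOp n)ᴴ * (l.map majorana).prod = 1 := by
    intro l
    induction l with
    | nil => simp
    | cons a l ih =>
      rw [List.map_cons, List.prod_cons, Matrix.conjTranspose_mul, majorana_conjTranspose, mul_assoc,
        ← mul_assoc (majorana a), majorana_mul_self, one_mul, ih]
  exact hl _

theorem majoranaProd_conjTranspose (S : Finset (Fin (2 * n))) :
    (orderedProd majorana S : QubitOp n)ᴴ = revSign S.card • orderedProd majorana S := by
  have h := majoranaProd_mul_self S
  calc (orderedProd majorana S : QubitOp n)ᴴ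
      = revSign S.card • ((orderedProd majorana S : QubitOp n)ᴴ *
          (revSign S.card • 1)) := by
        rw [mul_smul_comm, mul_one, smul_smul, Int.units_mul_self, one_smul]
    _ = _ := by rw [← h, ← mul_assoc, majoranaProd_conjTranspose_mul_self, one_mul]

/-- The sign for `S` is `(-1)^|S \ {a}|`. If `|S| + |T|` is even, any `a` in exactly one set works.
If it is odd, an `a` in both or in neither works; one exists, since otherwise `T = Sᶜ` and the
cardinalities would add up to the even number `2n`. -/
theorem exists_sign_ne_of_ne {S T : Finset (Fin (2 * n))} (h : S ≠ T) :
    ∃ a, (∏ b ∈ S, if b = a then (1 : ℤˣ) else -1) * (∏ b ∈ T, if b = a then (1 : ℤˣ) else -1)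
      = -1 := by
  have hs : ∀ (S : Finset (Fin (2 * n))) a,
      (∏ b ∈ S, if b = a then (1 : ℤˣ) else -1) = (-1) ^ (S.erase a).card := by
    intro S a
    rw [Finset.prod_ite]
    simp [Finset.filter_ne']
  have hodd : ∃ a, Odd ((S.erase a).card + (T.erase a).card) := by
    by_cases hp : Even (S.card + T.card)
    · obtain ⟨a, ha⟩ := not_forall.1 (mt Finset.ext_iff.2 h)
      refine ⟨a, ?_⟩
      rw [Finset.card_erase_eq_ite, Finset.card_erase_eq_ite]
      rw [Nat.odd_iff]
      rw [Nat.even_iff] at hp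
      by_cases hS : a ∈ S <;> by_cases hT : a ∈ T <;> simp [hS, hT] at ha ⊢
      · have := Finset.card_pos.2 ⟨a, hS⟩; omega
      · have := Finset.card_pos.2 ⟨a, hT⟩; omega
    · have : ∃ a, (a ∈ S ↔ a ∈ T) := by
        by_contra! hne
        have hST : T = Sᶜ := by
          ext a
          have := hne a
          rw [Finset.mem_compl]
          tauto
        apply hp
        rw [hST, Finset.card_add_card_compl]
        simp
      obtain ⟨a, ha⟩ := this
      refine ⟨a, ?_⟩
      rw [Finset.card_erase_eq_ite, Finset.card_erase_eq_ite, Nat.odd_iff]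
      rw [Nat.even_iff] at hp
      by_cases hS : a ∈ S
      · have hT := ha.1 hS
        have := Finset.card_pos.2 ⟨a, hS⟩
        have := Finset.card_pos.2 ⟨a, hT⟩
        simp only [hS, hT, if_true]; omega
      · have hT := mt ha.2 hS
        simp only [hS, hT, if_false]; omega
  obtain ⟨a, ha⟩ := hodd
  exact ⟨a, by rw [hs, hs, ← pow_add, ha.neg_one_pow]⟩

/-- For `S ≠ T`, conjugation by a suitable `c_a` preserves the trace and also negates it. -/
theorem trace_majoranaProd (S T : Finset (Fin (2 * n))) :
    ((orderedProd majorana S : QubitOp n)ᴴ * orderedProd majorana T).trace =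
      if S = T then (2 : ℂ) ^ n else 0 := by
  split_ifs with h
  · rw [h, majoranaProd_conjTranspose_mul_self, Matrix.trace_one]
    simp
  · obtain ⟨a, ha⟩ := exists_sign_ne_of_ne h
    have hS := mul_orderedProd_mul (majorana_anticomm (n := n)) majorana_mul_self a S
    have hT := mul_orderedProd_mul (majorana_anticomm (n := n)) majorana_mul_self a T
    generalize (∏ b ∈ S, if b = a then (1 : ℤˣ) else -1) = s at *
    generalize (∏ b ∈ T, if b = a then (1 : ℤˣ) else -1) = t at *
    have h1 : ((majorana a * orderedProd majorana S * majorana a : QubitOp n)ᴴ *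
        (majorana a * orderedProd majorana T * majorana a)).trace =
        ((orderedProd majorana S : QubitOp n)ᴴ * orderedProd majorana T).trace := by
      rw [Matrix.conjTranspose_mul, Matrix.conjTranspose_mul, majorana_conjTranspose]
      rw [mul_assoc (majorana a : QubitOp n) (orderedProd majorana T), mul_assoc, mul_assoc,
        ← mul_assoc (majorana a : QubitOp n) (majorana a), majorana_mul_self, one_mul,
        Matrix.trace_mul_comm, mul_assoc, mul_assoc, majorana_mul_self, mul_one]
    rw [hS, hT, units_smul_eq, units_smul_eq, Matrix.conjTranspose_smul, smul_mul_smul_comm,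
      Matrix.trace_smul] at h1
    have h2 : star ((s : ℤ) : ℂ) * ((t : ℤ) : ℂ) = -1 := by
      rcases Int.units_eq_one_or s with rfl | rfl <;>
        rcases Int.units_eq_one_or t with rfl | rfl <;> simp at ha ⊢
    rw [h2, neg_one_smul] at h1
    linear_combination (-1 / 2 : ℂ) * h1

theorem star_liouvilleVec_dotProduct (ρ σ : QubitOp n) :
    star (liouvilleVec ρ) ⬝ᵥ liouvilleVec σ = (ρᴴ * σ).trace := by
  simp only [liouvilleVec, dotProduct, Fintype.sum_prod_type, Matrix.trace, Matrix.diag_apply,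
    Matrix.mul_apply, Matrix.conjTranspose_apply, Pi.star_apply]
  rw [Finset.sum_comm]

/-- Vectorization as a linear equivalence. -/
def liouvilleEquiv (n : ℕ) : QubitOp n ≃ₗ[ℂ] LiouvilleSpace n where
  toFun := liouvilleVec
  invFun v := Matrix.of fun x y => v (x, y)
  map_add' _ _ := rfl
  map_smul' _ _ := rfl
  left_inv _ := rfl
  right_inv _ := rfl

theorem majoranaKet_eq (S : Finset (Fin (2 * n))) :
    majoranaKet S = ((Real.sqrt 2 : ℂ) ^ n)⁻¹ • liouvilleEquiv n (orderedProd majorana S) := rfl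

theorem majoranaKet_orthonormal (S T : Finset (Fin (2 * n))) :
    star (majoranaKet S) ⬝ᵥ majoranaKet T = if S = T then 1 else 0 := by
  have h2 : ((Real.sqrt 2 : ℝ) : ℂ) * (Real.sqrt 2 : ℝ) = 2 := by
    rw [← Complex.ofReal_mul, Real.mul_self_sqrt (by norm_num)]; simp
  rw [majoranaKet_eq, majoranaKet_eq, star_smul, smul_dotProduct, dotProduct_smul]
  change _ • _ • (star (liouvilleVec (orderedProd majorana S)) ⬝ᵥ
    liouvilleVec (orderedProd majorana T)) = _
  rw [star_liouvilleVec_dotProduct, trace_majoranaProd]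
  split_ifs
  · simp only [smul_eq_mul, star_inv₀, star_pow, Complex.star_def, Complex.conj_ofReal]
    rw [← mul_assoc, ← mul_inv, ← mul_pow, h2, inv_mul_cancel₀ (by simp)]
  · simp

theorem majoranaKet_linearIndependent : LinearIndependent ℂ (majoranaKet (n := n)) := by
  rw [Fintype.linearIndependent_iff]
  intro g hg T
  have := congrArg (fun v => star (majoranaKet T) ⬝ᵥ v) hg
  simpa [dotProduct_sum, dotProduct_smul, majoranaKet_orthonormal] using this

/-- The orthonormal basis of Majorana monomials. -/
def majoranaBasis (n : ℕ) : Module.Basis (Finset (Fin (2 * n))) ℂ (LiouvilleSpace n) :=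
  basisOfLinearIndependentOfCardEqFinrank majoranaKet_linearIndependent (by
    simp [← two_mul, Fintype.card_prod, ← pow_add])

@[simp] theorem majoranaBasis_apply (S : Finset (Fin (2 * n))) :
    majoranaBasis n S = majoranaKet S := by
  simp [majoranaBasis]

theorem repr_majoranaKet (S T : Finset (Fin (2 * n))) :
    (majoranaBasis n).repr (majoranaKet S) T = if S = T then 1 else 0 := by
  rw [← majoranaBasis_apply, Module.Basis.repr_self, Finsupp.single_apply]

theorem majorana_linearIndependent : LinearIndependent ℂ (majorana (n := n)) := by
  have h := (majoranaKet_linearIndependent (n := n)).comp (fun a : Fin (2 * n) => {a})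
    Finset.singleton_injective
  rw [Fintype.linearIndependent_iff] at h ⊢
  intro g hg
  refine h g ?_
  have := congrArg (fun v => ((Real.sqrt 2 : ℂ) ^ n)⁻¹ • liouvilleEquiv n v) hg
  simp only [map_sum, map_smul, map_zero, smul_zero, Finset.smul_sum] at this
  simpa [majoranaKet_eq, smul_comm (g _)] using this

theorem trace_majorana_mul (a b : Fin (2 * n)) :
    ((majorana a : QubitOp n) * majorana b).trace = if a = b then (2 : ℂ) ^ n else 0 := by
  have h := trace_majoranaProd ({a} : Finset (Fin (2 * n))) {b}
  simpa [majorana_conjTranspose] using h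

end Orthonormality

/-! ### The homomorphism to `SO(2n)`. -/

section Rotation

variable {n : ℕ}

theorem conj_eq_of_mul_eq (U : Matrix.unitaryGroup (Fin n → Fin 2) ℂ) {ρ σ : QubitOp n}
    (h : (U : QubitOp n) * ρ = σ * U) : Unitary.conjStarAlgAut ℂ (QubitOp n) U ρ = σ := by
  have hU : (U : QubitOp n) * star (U : QubitOp n) = 1 := Matrix.mem_unitaryGroup_iff.1 U.2
  rw [Unitary.conjStarAlgAut_apply, h, mul_assoc, hU, mul_one]

theorem conj_parity_of_mem {U : Matrix.unitaryGroup (Fin n → Fin 2) ℂ} (hU : U ∈ matchgateGroup n) :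
    Unitary.conjStarAlgAut ℂ (QubitOp n) U (orderedProd majorana Finset.univ) =
      orderedProd majorana Finset.univ := by
  induction hU using Subgroup.closure_induction with
  | mem U h =>
    obtain ⟨k, k', hk, A, -, B, -, hU⟩ := h
    exact conj_eq_of_mul_eq U (by rw [hU, onQubits_matchgate_comm_parity hk])
  | one => simp
  | mul U V _ _ hU hV => rw [Unitary.conjStarAlgAut_mul_apply, hV, hU]
  | inv U _ hU =>
    rw [map_inv]
    conv_lhs => rw [← hU]
    exact StarAlgEquiv.symm_apply_apply _ _

theorem conj_majorana_mem_span_of_generator {U : Matrix.unitaryGroup (Fin n → Fin 2) ℂ}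
    {k k' : Fin n} (hk : (k' : ℕ) = k + 1) {A B : Matrix (Fin 2) (Fin 2) ℂ}
    (hA : A ∈ Matrix.specialUnitaryGroup (Fin 2) ℂ) (hB : B ∈ Matrix.specialUnitaryGroup (Fin 2) ℂ)
    (hU : (U : QubitOp n) = onQubits k k' (matchgate A B)) (l : Fin (2 * n)) :
    Unitary.conjStarAlgAut ℂ (QubitOp n) U (majorana l) ∈
      Submodule.span ℝ (Set.range (majorana (n := n))) := by
  by_cases h : (l : ℕ) / 2 = k ∨ (l : ℕ) / 2 = k'
  · obtain ⟨j, hj⟩ : ∃ j : Fin 4, (l : ℕ) = 2 * k + j := ⟨⟨l - 2 * k, by omega⟩, by simp; omega⟩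
    rw [show l = ⟨2 * k + j, by omega⟩ from Fin.ext hj]
    obtain ⟨r, hr⟩ := localBlock_conj hA hB j
    have hA' : Aᴴ * A = 1 := Matrix.mem_unitaryGroup_iff'.1 hA.1
    have hB' : Bᴴ * B = 1 := Matrix.mem_unitaryGroup_iff'.1 hB.1
    have := onQubits_matchgate_mul_majorana hk (A := A) (B := B) (r := r) (j := j)
      (by rw [← hr, mul_assoc, hB', mul_one])
      (by rw [← hr, Matrix.conjTranspose_mul, Matrix.conjTranspose_mul,
            Matrix.conjTranspose_conjTranspose, mul_assoc, mul_assoc, hA', mul_one])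
    rw [← hU] at this
    simp only [← smul_mul_assoc, ← Finset.sum_mul] at this
    rw [conj_eq_of_mul_eq U this]
    exact Submodule.sum_mem _ fun i _ => Submodule.smul_mem _ _ (Submodule.subset_span ⟨_, rfl⟩)
  · rw [not_or] at h
    rw [conj_eq_of_mul_eq U (σ := majorana l)
      (by rw [hU, onQubits_matchgate_comm_majorana hk A B h.1 h.2])]
    exact Submodule.subset_span ⟨_, rfl⟩

theorem conj_majorana_mem_span {U : Matrix.unitaryGroup (Fin n → Fin 2) ℂ}
    (hU : U ∈ matchgateGroup n) : ∀ x ∈ Submodule.span ℝ (Set.range (majorana (n := n))),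
    Unitary.conjStarAlgAut ℂ (QubitOp n) U x ∈
      Submodule.span ℝ (Set.range (majorana (n := n))) := by
  let f (U : Matrix.unitaryGroup (Fin n → Fin 2) ℂ) : QubitOp n ≃ₗ[ℝ] QubitOp n :=
    (Unitary.conjStarAlgAut ℂ (QubitOp n) U).toAlgEquiv.toLinearEquiv.restrictScalars ℝ
  suffices h : (Submodule.span ℝ (Set.range (majorana (n := n)))).map (f U : _ →ₗ[ℝ] _) ≤
      Submodule.span ℝ (Set.range (majorana (n := n))) from
    fun x hx => h ⟨x, hx, rfl⟩
  induction hU using Subgroup.closure_induction with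
  | mem U h =>
    obtain ⟨k, k', hk, A, hA, B, hB, hU⟩ := h
    rw [Submodule.map_span, Submodule.span_le]
    rintro _ ⟨_, ⟨l, rfl⟩, rfl⟩
    exact conj_majorana_mem_span_of_generator hk hA hB hU l
  | one =>
    rintro _ ⟨x, hx, rfl⟩
    simpa [f] using hx
  | mul U V _ _ hU hV =>
    rintro _ ⟨x, hx, rfl⟩
    have := hU ⟨_, hV ⟨x, hx, rfl⟩, rfl⟩
    simpa [f, mul_assoc] using this
  -- An injective linear map carrying a finite-dimensional space into itself is onto it, so the
  -- inverse preserves the span as well.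
  | inv U _ hU =>
    have hfin : FiniteDimensional ℝ (Submodule.span ℝ (Set.range (majorana (n := n)))) :=
      FiniteDimensional.span_of_finite ℝ (Set.finite_range _)
    have heq := Submodule.eq_of_le_of_finrank_eq hU (LinearEquiv.finrank_map_eq (f U) _)
    rintro _ ⟨x, hx, rfl⟩
    rw [← heq] at hx
    obtain ⟨y, hy, rfl⟩ := hx
    have : f U⁻¹ (f U y) = y := by
      change Unitary.conjStarAlgAut ℂ (QubitOp n) U⁻¹ (Unitary.conjStarAlgAut ℂ (QubitOp n) U y) = y
      rw [← Unitary.conjStarAlgAut_mul_apply, inv_mul_cancel, map_one]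
      rfl
    change f U⁻¹ (f U y) ∈ _
    rw [this]
    exact hy

/-- Conjugation by a matchgate circuit. -/
def gateConj (U : matchgateGroup n) : QubitOp n ≃⋆ₐ[ℂ] QubitOp n :=
  Unitary.conjStarAlgAut ℂ (QubitOp n) U

theorem gateConj_apply (U : matchgateGroup n) (ρ : QubitOp n) :
    gateConj U ρ = gateOp U * ρ * (gateOp U)ᴴ := rfl

theorem gateConj_mul (U V : matchgateGroup n) (ρ : QubitOp n) :
    gateConj (U * V) ρ = gateConj U (gateConj V ρ) :=
  Unitary.conjStarAlgAut_mul_apply _ _ _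

theorem gateConj_one (ρ : QubitOp n) : gateConj (1 : matchgateGroup n) ρ = ρ := by
  simp [gateConj]

theorem gateConj_parity (U : matchgateGroup n) :
    gateConj U (orderedProd majorana Finset.univ) = orderedProd majorana Finset.univ :=
  conj_parity_of_mem U.2

theorem naturalRep_liouvilleEquiv (U : matchgateGroup n) (ρ : QubitOp n) :
    naturalRep n U (liouvilleEquiv n ρ) = liouvilleEquiv n (gateConj U ρ) :=
  naturalRep_liouvilleVec U ρ

theorem trace_gateConj (U : matchgateGroup n) (ρ : QubitOp n) :
    (gateConj U ρ).trace = ρ.trace := by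
  have h : (gateOp U)ᴴ * gateOp U = 1 := Matrix.mem_unitaryGroup_iff'.1 U.1.2
  rw [gateConj_apply, Matrix.trace_mul_comm, ← mul_assoc, h, one_mul]

theorem exists_rotation (U : matchgateGroup n) : ∃ r : Matrix (Fin (2 * n)) (Fin (2 * n)) ℝ,
    ∀ l, gateConj U (majorana l) = ∑ m, ((r m l : ℝ) : ℂ) • majorana m := by
  have h : ∀ l, ∃ r : Fin (2 * n) → ℝ, ∑ m, r m • majorana m = gateConj U (majorana l) := fun l =>
    (Submodule.mem_span_range_iff_exists_fun ℝ).1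
      (conj_majorana_mem_span U.2 _ (Submodule.subset_span ⟨l, rfl⟩))
  choose r hr using h
  exact ⟨Matrix.of fun m l => r l m, fun l => by simp [← hr]⟩

/-- Conjugation preserves the trace form, for which the Majorana operators are orthogonal of equal
norm. -/
theorem rotation_orthogonal {U : matchgateGroup n} {r : Matrix (Fin (2 * n)) (Fin (2 * n)) ℝ}
    (hr : ∀ l, gateConj U (majorana l) = ∑ m, ((r m l : ℝ) : ℂ) • majorana m) : rᵀ * r = 1 := by
  ext a b
  have h : (gateConj U (majorana a) * gateConj U (majorana b)).trace =
      if a = b then (2 : ℂ) ^ n else 0 := by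
    rw [← map_mul, trace_gateConj, trace_majorana_mul]
  rw [hr, hr] at h
  simp only [Finset.sum_mul, Finset.mul_sum, smul_mul_smul_comm, Matrix.trace_sum,
    Matrix.trace_smul, trace_majorana_mul, mul_ite, mul_zero, Finset.sum_ite_eq',
    Finset.mem_univ, if_true, smul_eq_mul] at h
  rw [← Finset.sum_mul] at h
  have h2 : (2 : ℂ) ^ n ≠ 0 := by simp
  have h3 : (∑ i, (r i a : ℂ) * (r i b : ℂ)) = if a = b then 1 else 0 := by
    split_ifs at h ⊢
    · exact mul_right_cancel₀ h2 (by rw [one_mul]; exact h)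
    · exact mul_right_cancel₀ h2 (by rw [zero_mul]; exact h)
  rw [Matrix.mul_apply, Matrix.one_apply]
  simp only [Matrix.transpose_apply]
  apply Complex.ofReal_injective
  push_cast
  rw [h3]
  split_ifs <;> simp

/-- The linear extension of `e_m ↦ c_m`. -/
def majoranaMap (n : ℕ) : (Fin (2 * n) → ℂ) →ₗ[ℂ] QubitOp n :=
  Fintype.linearCombination ℂ majorana

theorem majoranaMap_single (m : Fin (2 * n)) : majoranaMap n (Pi.single m 1) = majorana m := by
  simp [majoranaMap, Fintype.linearCombination_apply_single]

/-- The antisymmetrized product of Majorana operators. -/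
def majoranaWedge (n i : ℕ) : (Fin (2 * n) → ℂ) [⋀^Fin i]→ₗ[ℂ] QubitOp n :=
  ((i.factorial : ℂ)⁻¹) • MultilinearMap.alternatization
    ((MultilinearMap.mkPiAlgebraFin ℂ i (QubitOp n)).compLinearMap fun _ => majoranaMap n)

theorem majoranaWedge_apply (i : ℕ) (v : Fin i → Fin (2 * n) → ℂ) :
    majoranaWedge n i v = ((i.factorial : ℂ)⁻¹) •
      ∑ σ : Equiv.Perm (Fin i), Equiv.Perm.sign σ • (List.ofFn ((majoranaMap n ∘ v) ∘ σ)).prod := by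
  rw [majoranaWedge, AlternatingMap.smul_apply, MultilinearMap.alternatization_apply]
  congr 1

/-- For distinct Majorana operators all `i!` signed terms coincide, which explains the
normalization. Antisymmetrizing is needed because products of arbitrary linear combinations are not
alternating. -/
theorem majoranaWedge_single {i : ℕ} {S : Finset (Fin (2 * n))} (hS : S.card = i) :
    majoranaWedge n i (fun a => Pi.single (S.orderEmbOfFin hS a) 1) = orderedProd majorana S := by
  rw [majoranaWedge_apply]
  have h1 : (majoranaMap n ∘ fun a => Pi.single (S.orderEmbOfFin hS a) (1 : ℂ)) =
      majorana ∘ S.orderEmbOfFin hS := by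
    funext a
    exact majoranaMap_single _
  have h2 : ∀ σ : Equiv.Perm (Fin i), Equiv.Perm.sign σ •
      (List.ofFn (((majorana : _ → QubitOp n) ∘ S.orderEmbOfFin hS) ∘ σ)).prod =
      orderedProd majorana S := by
    intro σ
    rw [prod_ofFn_comp_perm (majorana ∘ _)
      (fun a b hab => majorana_anticomm ((S.orderEmbOfFin hS).injective.ne hab)), smul_smul,
      Int.units_mul_self, one_smul, ← orderedProd_eq_prod_ofFn]
  simp only [h1, h2]
  rw [Finset.sum_const, Finset.card_univ, Fintype.card_perm, Fintype.card_fin,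
    ← Nat.cast_smul_eq_nsmul ℂ, smul_smul, inv_mul_cancel₀ (by simp [Nat.factorial_ne_zero]),
    one_smul]

theorem gateConj_majoranaWedge (U : matchgateGroup n) {g : (Fin (2 * n) → ℂ) →ₗ[ℂ] Fin (2 * n) → ℂ}
    (hg : ∀ v, gateConj U (majoranaMap n v) = majoranaMap n (g v)) (i : ℕ)
    (v : Fin i → Fin (2 * n) → ℂ) :
    gateConj U (majoranaWedge n i v) = majoranaWedge n i (g ∘ v) := by
  simp only [majoranaWedge_apply, map_smul, map_sum, units_smul_eq, map_list_prod, List.map_ofFn]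
  congr 1
  refine Finset.sum_congr rfl fun σ _ => ?_
  congr 3
  funext a
  exact hg _

theorem gateConj_majoranaMap {U : matchgateGroup n} {r : Matrix (Fin (2 * n)) (Fin (2 * n)) ℝ}
    (hr : ∀ l, gateConj U (majorana l) = ∑ m, ((r m l : ℝ) : ℂ) • majorana m)
    (v : Fin (2 * n) → ℂ) :
    gateConj U (majoranaMap n v) = majoranaMap n (Matrix.toLin' (r.map Complex.ofReal) v) := by
  simp only [majoranaMap, Fintype.linearCombination_apply, map_sum, map_smul, hr, Finset.smul_sum,
    smul_smul, Matrix.toLin'_apply, Matrix.mulVec, dotProduct, Finset.sum_smul, Matrix.map_apply]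
  rw [Finset.sum_comm]
  simp only [mul_comm]

/-- In top degree an alternating map is multiplied by the determinant, while the product of all
Majorana operators is nonzero and fixed. -/
theorem rotation_det {U : matchgateGroup n} {r : Matrix (Fin (2 * n)) (Fin (2 * n)) ℝ}
    (hr : ∀ l, gateConj U (majorana l) = ∑ m, ((r m l : ℝ) : ℂ) • majorana m) : r.det = 1 := by
  have hcard : (Finset.univ : Finset (Fin (2 * n))).card = 2 * n := by simp
  set g := Matrix.toLin' (r.map Complex.ofReal) with hg
  have h1 := gateConj_majoranaWedge U (g := g) (gateConj_majoranaMap hr) (2 * n)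
    (fun a => Pi.single (Finset.univ.orderEmbOfFin hcard a) 1)
  rw [majoranaWedge_single hcard, gateConj_parity] at h1
  have he : ∀ a, (Finset.univ : Finset (Fin (2 * n))).orderEmbOfFin hcard a = a := fun a =>
    (congrFun (Finset.orderEmbOfFin_unique hcard (f := id) (by simp) strictMono_id) a).symm
  have h2 : ∀ f : (Fin (2 * n) → ℂ) [⋀^Fin (2 * n)]→ₗ[ℂ] ℂ,
      f (g ∘ fun a => Pi.single a 1) = (r.det : ℂ) * f fun a => Pi.single a 1 := by
    intro f
    have hf := f.eq_smul_basis_det (Pi.basisFun ℂ (Fin (2 * n)))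
    have hb : (⇑(Pi.basisFun ℂ (Fin (2 * n)))) = fun a => Pi.single a (1 : ℂ) := by
      funext a; simp
    have hdet : LinearMap.det g = (r.det : ℂ) := by
      rw [hg, LinearMap.det_toLin']
      exact (RingHom.map_det Complex.ofRealHom r).symm
    have h3 := congrArg (fun F => F (g ∘ Pi.basisFun ℂ (Fin (2 * n)))) hf
    simp only [AlternatingMap.smul_apply, Module.Basis.det_comp, Module.Basis.det_self, mul_one,
      smul_eq_mul, hdet] at h3
    rw [hb] at h3
    rw [h3, mul_comm]
  have hne : liouvilleEquiv n (orderedProd majorana Finset.univ) ≠ 0 := by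
    intro h0
    have := (majoranaBasis n).ne_zero Finset.univ
    rw [majoranaBasis_apply, majoranaKet_eq, h0, smul_zero] at this
    exact this rfl
  simp only [he] at h1
  obtain ⟨p, hp⟩ := Function.ne_iff.1 hne
  -- A matrix entry at which the full product does not vanish turns the operator-valued form into a
  -- scalar one.
  let φ : QubitOp n →ₗ[ℂ] ℂ := LinearMap.proj p ∘ₗ (liouvilleEquiv n).toLinearMap
  have h3 := h2 (φ.compAlternatingMap (majoranaWedge n (2 * n)))
  have h4 := majoranaWedge_single hcard
  simp only [he] at h4
  rw [LinearMap.compAlternatingMap_apply, LinearMap.compAlternatingMap_apply, ← h1, h4] at h3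
  have h5 : (r.det : ℂ) = 1 := (mul_right_cancel₀ hp (by rw [one_mul]; exact h3)).symm
  exact_mod_cast h5

theorem exists_rotation_hom (n : ℕ) :
    ∃ R : matchgateGroup n →* Matrix.specialOrthogonalGroup (Fin (2 * n)) ℝ,
      ∀ U l, gateConj U (majorana l) =
        ∑ m, (((R U : Matrix (Fin (2 * n)) (Fin (2 * n)) ℝ) m l : ℝ) : ℂ) • majorana m := by
  choose r hr using exists_rotation (n := n)
  have hmem : ∀ U, r U ∈ Matrix.specialOrthogonalGroup (Fin (2 * n)) ℝ := fun U =>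
    Matrix.mem_specialOrthogonalGroup_iff.2
      ⟨Matrix.mem_orthogonalGroup_iff' _ _ |>.2 (rotation_orthogonal (hr U)), rotation_det (hr U)⟩
  refine ⟨MonoidHom.mk' (fun U => ⟨r U, hmem U⟩) fun U V => Subtype.ext ?_, hr⟩
  change r (U * V) = r U * r V
  ext m l
  have h := gateConj_mul U V (majorana l)
  rw [hr, hr] at h
  simp only [map_sum, map_smul, hr, Finset.smul_sum, smul_smul] at h
  rw [Finset.sum_comm] at h
  simp only [← Finset.sum_smul] at h
  -- Linear independence determines the rotation matrix uniquely, so multiplicativity can be read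
  -- off from coefficients.
  have := Fintype.linearIndependent_iff.1 majorana_linearIndependent _
    ((Finset.sum_sub_distrib _ _).trans (sub_eq_zero.2 h) |> fun h => by
      simpa only [← sub_smul] using h) m
  rw [sub_eq_zero] at this
  apply Complex.ofReal_injective
  rw [this, Matrix.mul_apply]
  push_cast
  exact Finset.sum_congr rfl fun _ _ => mul_comm _ _

end Rotation

/-! ### The Hodge star and the two halves of the middle degree. -/

section Hodge

variable {n : ℕ}

/-- Right multiplication by the product of all Majorana operators. -/
def rightParity (n : ℕ) : LiouvilleSpace n →ₗ[ℂ] LiouvilleSpace n :=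
  (liouvilleEquiv n).toLinearMap ∘ₗ
    LinearMap.mulRight ℂ (orderedProd majorana Finset.univ : QubitOp n) ∘ₗ
      (liouvilleEquiv n).symm.toLinearMap

theorem rightParity_liouvilleEquiv (ρ : QubitOp n) :
    rightParity n (liouvilleEquiv n ρ) = liouvilleEquiv n (ρ * orderedProd majorana Finset.univ) := by
  simp [rightParity]

/-- Split the full product as a sign times `c_S c_{Sᶜ}`; the factor `c_S` then meets itself and
leaves only a sign. -/
theorem rightParity_majoranaKet (S : Finset (Fin (2 * n))) :
    rightParity n (majoranaKet S) =
      (((revSign S.card : ℤ) : ℂ) * ((complementSign S : ℤ) : ℂ)) • majoranaKet Sᶜ := by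
  rw [majoranaKet_eq, map_smul, rightParity_liouvilleEquiv,
    orderedProd_univ_eq majorana_anticomm S, mul_smul_comm, ← mul_assoc, majoranaProd_mul_self,
    smul_mul_assoc, one_mul, units_smul_eq, units_smul_eq, majoranaKet_eq, map_smul, map_smul,
    smul_smul, smul_smul, smul_smul]
  congr 1
  ring

theorem naturalRep_rightParity (U : matchgateGroup n) (v : LiouvilleSpace n) :
    naturalRep n U (rightParity n v) = rightParity n (naturalRep n U v) := by
  obtain ⟨ρ, rfl⟩ := (liouvilleEquiv n).surjective v
  rw [rightParity_liouvilleEquiv, naturalRep_liouvilleEquiv, naturalRep_liouvilleEquiv,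
    rightParity_liouvilleEquiv, map_mul, gateConj_parity]

theorem rightParity_rightParity (v : LiouvilleSpace n) :
    rightParity n (rightParity n v) = (-1 : ℂ) ^ n • v := by
  obtain ⟨ρ, rfl⟩ := (liouvilleEquiv n).surjective v
  have h : (orderedProd majorana Finset.univ : QubitOp n) * orderedProd majorana Finset.univ =
      (-1 : ℂ) ^ n • 1 := by
    rw [orderedProd_majorana_univ, tensorOp_mul]
    have : (Complex.I • pauliZ) * (Complex.I • pauliZ) =
        (-1 : ℂ) • (1 : Matrix (Fin 2) (Fin 2) ℂ) := by
      rw [smul_mul_smul_comm, pauliZ_mul_self, Complex.I_mul_I]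
    simp only [this]
    rw [tensorOp_smul (fun _ => (-1 : ℂ)) (fun _ : Fin n => 1)]
    simp
  rw [rightParity_liouvilleEquiv, rightParity_liouvilleEquiv, mul_assoc, h, mul_smul_comm, mul_one,
    map_smul]

/-- The involution `i^n ⋆` of the middle degree, extended to Liouville space. -/
def chirality (n : ℕ) : LiouvilleSpace n →ₗ[ℂ] LiouvilleSpace n :=
  (Complex.I ^ n * ((revSign n : ℤ) : ℂ)) • rightParity n

/-- The factor `revSign n` in `chirality` cancels the one produced by `rightParity` in degree `n`,
which leaves the coefficient used in `halfSpace`. -/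
theorem chirality_majoranaKet {S : Finset (Fin (2 * n))} (hS : S.card = n) :
    chirality n (majoranaKet S) =
      (Complex.I ^ n * ((complementSign S : ℤ) : ℂ)) • majoranaKet Sᶜ := by
  rw [chirality, LinearMap.smul_apply, rightParity_majoranaKet, hS, smul_smul]
  congr 1
  linear_combination (Complex.I ^ n * ((complementSign S : ℤ) : ℂ)) *
    units_cast_mul_self (revSign n)

theorem chirality_chirality (v : LiouvilleSpace n) : chirality n (chirality n v) = v := by
  simp only [chirality, LinearMap.smul_apply, map_smul, rightParity_rightParity, smul_smul]
  have hI : Complex.I ^ n * Complex.I ^ n * (-1) ^ n = 1 := by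
    rw [← mul_pow, ← mul_pow, Complex.I_mul_I]; simp
  rw [show Complex.I ^ n * ((revSign n : ℤ) : ℂ) * (Complex.I ^ n * ((revSign n : ℤ) : ℂ)
    * (-1) ^ n) = 1 by
      linear_combination units_cast_mul_self (revSign n) * (Complex.I ^ n * Complex.I ^ n * (-1) ^ n)
        + hI, one_smul]

theorem naturalRep_chirality (U : matchgateGroup n) (v : LiouvilleSpace n) :
    naturalRep n U (chirality n v) = chirality n (naturalRep n U v) := by
  rw [chirality, LinearMap.smul_apply, LinearMap.smul_apply, map_smul, naturalRep_rightParity]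

theorem card_compl_of_card {S : Finset (Fin (2 * n))} (hS : S.card = n) : Sᶜ.card = n := by
  rw [Finset.card_compl, hS, Fintype.card_fin]; omega

theorem majoranaKet_mem_degreeSpace {S : Finset (Fin (2 * n))} {i : ℕ} (hS : S.card = i) :
    majoranaKet S ∈ degreeSpace n i := Submodule.subset_span ⟨S, hS, rfl⟩

theorem chirality_mem_degreeSpace {v : LiouvilleSpace n} (hv : v ∈ degreeSpace n n) :
    chirality n v ∈ degreeSpace n n := by
  induction hv using Submodule.span_induction with
  | mem x hx =>
    obtain ⟨S, hS, rfl⟩ := hx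
    rw [chirality_majoranaKet hS]
    exact Submodule.smul_mem _ _ (majoranaKet_mem_degreeSpace (card_compl_of_card hS))
  | zero => simp
  | add x y _ _ hx hy => rw [map_add]; exact Submodule.add_mem _ hx hy
  | smul a x _ hx => rw [map_smul]; exact Submodule.smul_mem _ _ hx

theorem halfSpace_eq_map (ε : ℤˣ) : halfSpace n ε =
    (degreeSpace n n).map (LinearMap.id + ((ε : ℤ) : ℂ) • chirality n) := by
  rw [degreeSpace, Submodule.map_span, halfSpace]
  congr 1
  ext v
  constructor
  · rintro ⟨S, hS, rfl⟩
    exact ⟨_, ⟨S, hS, rfl⟩, by simp [chirality_majoranaKet hS, smul_smul, mul_assoc]⟩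
  · rintro ⟨_, ⟨S, hS, rfl⟩, rfl⟩
    exact ⟨S, hS, by simp [chirality_majoranaKet hS, smul_smul, mul_assoc]⟩

/-- Since chirality is an involution, `1 + ε · chirality` is twice the projection onto its
`ε`-eigenspace. -/
theorem mem_halfSpace {ε : ℤˣ} {v : LiouvilleSpace n} : v ∈ halfSpace n ε ↔
    v ∈ degreeSpace n n ∧ chirality n v = ((ε : ℤ) : ℂ) • v := by
  rw [halfSpace_eq_map]
  constructor
  · rintro ⟨w, hw, rfl⟩
    refine ⟨Submodule.add_mem _ hw (Submodule.smul_mem _ _ (chirality_mem_degreeSpace hw)), ?_⟩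
    simp only [LinearMap.add_apply, LinearMap.id_apply, LinearMap.smul_apply, map_add, map_smul,
      chirality_chirality, smul_add, smul_smul, units_cast_mul_self, one_smul]
    rw [add_comm]
  · rintro ⟨hv, h⟩
    refine ⟨(1 / 2 : ℂ) • v, Submodule.smul_mem _ _ hv, ?_⟩
    simp only [LinearMap.add_apply, LinearMap.id_apply, LinearMap.smul_apply, map_smul, h, smul_smul,
      units_cast_mul_self, one_smul]
    module

theorem halfSpace_sup : halfSpace n 1 ⊔ halfSpace n (-1) = degreeSpace n n := by
  apply le_antisymm
  · exact sup_le (fun v hv => (mem_halfSpace.1 hv).1) (fun v hv => (mem_halfSpace.1 hv).1)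
  · intro v hv
    have h : v = (1 / 2 : ℂ) • (v + chirality n v) + (1 / 2 : ℂ) • (v - chirality n v) := by
      module
    rw [h]
    have hc := chirality_mem_degreeSpace hv
    refine Submodule.add_mem_sup (Submodule.smul_mem _ _ (mem_halfSpace.2 ⟨?_, ?_⟩))
      (Submodule.smul_mem _ _ (mem_halfSpace.2 ⟨?_, ?_⟩))
    · exact Submodule.add_mem _ hv hc
    · simp [chirality_chirality, add_comm]
    · exact Submodule.sub_mem _ hv hc
    · simp [chirality_chirality]

theorem halfSpace_inf : halfSpace n 1 ⊓ halfSpace n (-1) = ⊥ := by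
  rw [eq_bot_iff]
  rintro v ⟨h1, h2⟩
  have h := (mem_halfSpace.1 h1).2.symm.trans (mem_halfSpace.1 h2).2
  simp only [Units.val_one, Int.cast_one, one_smul, Units.val_neg, Int.cast_neg, neg_smul] at h
  exact self_eq_neg.1 h

theorem mem_degreeSpace {i : ℕ} {v : LiouvilleSpace n} :
    v ∈ degreeSpace n i ↔ ∀ S, (majoranaBasis n).repr v S ≠ 0 → S.card = i := by
  have h : degreeSpace n i =
      Submodule.span ℂ (majoranaBasis n '' {S : Finset (Fin (2 * n)) | S.card = i}) := by
    rw [degreeSpace]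
    congr 1
    ext v
    simp [eq_comm]
  rw [h, Module.Basis.mem_span_image]
  simp [Set.subset_def]

end Hodge

/-! ### Exterior powers and the degree spaces as subrepresentations. -/

section ExteriorPowers

variable {n : ℕ}

/-- The map `e_{m_1} ∧ ⋯ ∧ e_{m_i} ↦ |m_1 ⋯ m_i⟩⟩`. -/
def wedgeToLiouville (n i : ℕ) : ⋀[ℂ]^i (Fin (2 * n) → ℂ) →ₗ[ℂ] LiouvilleSpace n :=
  ((Real.sqrt 2 : ℂ) ^ n)⁻¹ • (liouvilleEquiv n).toLinearMap ∘ₗ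
    exteriorPower.alternatingMapLinearEquiv (majoranaWedge n i)

theorem wedgeToLiouville_ιMulti (i : ℕ) (v : Fin i → Fin (2 * n) → ℂ) :
    wedgeToLiouville n i (exteriorPower.ιMulti ℂ i v) =
      ((Real.sqrt 2 : ℂ) ^ n)⁻¹ • liouvilleEquiv n (majoranaWedge n i v) := by
  simp [wedgeToLiouville, -exteriorPower.ιMulti_apply_coe]

theorem wedgeToLiouville_single {i : ℕ} {S : Finset (Fin (2 * n))} (hS : S.card = i) :
    wedgeToLiouville n i (exteriorPower.ιMulti ℂ i fun a => Pi.single (S.orderEmbOfFin hS a) 1) =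
      majoranaKet S := by
  rw [wedgeToLiouville_ιMulti, majoranaWedge_single, majoranaKet_eq]

theorem wedgeToLiouville_basis (i : ℕ) (s : Set.powersetCard (Fin (2 * n)) i) :
    wedgeToLiouville n i ((Pi.basisFun ℂ (Fin (2 * n))).exteriorPower i s) =
      majoranaKet (s : Finset (Fin (2 * n))) := by
  rw [← wedgeToLiouville_single (i := i) (Set.powersetCard.card_eq s), exteriorPower.basis_apply,
    exteriorPower.ιMulti_family]
  congr 2
  funext a
  simp only [Function.comp_apply, Pi.basisFun_apply]
  congr 2

theorem wedgeToLiouville_injective (i : ℕ) : Function.Injective (wedgeToLiouville n i) := by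
  have h := (majoranaKet_linearIndependent (n := n)).comp
    (fun s : Set.powersetCard (Fin (2 * n)) i => (s : Finset (Fin (2 * n)))) Subtype.coe_injective
  refine (injective_iff_map_eq_zero _).2 fun x hx => ?_
  rw [← ((Pi.basisFun ℂ (Fin (2 * n))).exteriorPower i).linearCombination_repr x,
    Finsupp.apply_linearCombination] at hx
  have h' := h (a₁ := ((Pi.basisFun ℂ (Fin (2 * n))).exteriorPower i).repr x) (a₂ := 0) (by
    rw [map_zero, ← hx]
    congr 2
    funext s
    exact (wedgeToLiouville_basis i s).symm)
  exact (LinearEquiv.map_eq_zero_iff _).1 h'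

theorem range_wedgeToLiouville (i : ℕ) :
    LinearMap.range (wedgeToLiouville n i) = degreeSpace n i := by
  rw [LinearMap.range_eq_map, ← ((Pi.basisFun ℂ (Fin (2 * n))).exteriorPower i).span_eq,
    Submodule.map_span, degreeSpace]
  congr 1
  ext v
  constructor
  · rintro ⟨_, ⟨s, rfl⟩, rfl⟩
    exact ⟨_, Set.powersetCard.card_eq s, wedgeToLiouville_basis i s⟩
  · rintro ⟨S, hS, rfl⟩
    exact ⟨_, ⟨⟨S, hS⟩, rfl⟩, wedgeToLiouville_basis i ⟨S, hS⟩⟩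

theorem naturalRep_wedgeToLiouville
    {R : matchgateGroup n →* Matrix.specialOrthogonalGroup (Fin (2 * n)) ℝ}
    (hR : ∀ U l, gateConj U (majorana l) =
      ∑ m, (((R U : Matrix (Fin (2 * n)) (Fin (2 * n)) ℝ) m l : ℝ) : ℂ) • majorana m)
    (i : ℕ) (U : matchgateGroup n) :
    naturalRep n U ∘ₗ wedgeToLiouville n i =
      wedgeToLiouville n i ∘ₗ exteriorPowerRep ((specialOrthogonalRep (2 * n)).comp R) i U := by
  apply exteriorPower.linearMap_ext
  ext1 v
  simp only [LinearMap.compAlternatingMap_apply, LinearMap.comp_apply]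
  have h : exteriorPowerRep ((specialOrthogonalRep (2 * n)).comp R) i U
      (exteriorPower.ιMulti ℂ i v) = exteriorPower.ιMulti ℂ i
        (Matrix.toLin' ((R U : Matrix (Fin (2 * n)) (Fin (2 * n)) ℝ).map Complex.ofReal) ∘ v) :=
    exteriorPower.map_apply_ιMulti _ _
  rw [h, wedgeToLiouville_ιMulti, wedgeToLiouville_ιMulti, map_smul, naturalRep_liouvilleEquiv,
    gateConj_majoranaWedge U (gateConj_majoranaMap (hR U))]

/-- The degree space is the image of an equivariant map from an exterior power. -/
theorem naturalRep_mem_degreeSpace (U : matchgateGroup n) (i : ℕ) {v : LiouvilleSpace n}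
    (hv : v ∈ degreeSpace n i) : naturalRep n U v ∈ degreeSpace n i := by
  obtain ⟨R, hR⟩ := exists_rotation_hom n
  rw [← range_wedgeToLiouville] at hv ⊢
  obtain ⟨x, rfl⟩ := hv
  exact ⟨_, (LinearMap.congr_fun (naturalRep_wedgeToLiouville hR i U) x).symm⟩

/-- `H_i` as a subrepresentation. -/
def degreeRep (n i : ℕ) : Subrepresentation (naturalRep n) where
  toSubmodule := degreeSpace n i
  apply_mem_toSubmodule U _ hv := naturalRep_mem_degreeSpace U i hv

/-- `H_{n,1}` and `H_{n,2}` as subrepresentations. -/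
def halfRep (n : ℕ) (ε : ℤˣ) : Subrepresentation (naturalRep n) where
  toSubmodule := halfSpace n ε
  apply_mem_toSubmodule U v hv := by
    obtain ⟨h1, h2⟩ := mem_halfSpace.1 hv
    exact mem_halfSpace.2 ⟨naturalRep_mem_degreeSpace U n h1, by
      rw [← naturalRep_chirality, h2, map_smul]⟩

/-- The summands of Liouville space. -/
def irrep (n : ℕ) : IrrepLabel n → Subrepresentation (naturalRep n) :=
  Sum.elim (fun i => degreeRep n (i : Fin (2 * n + 1))) (halfRep n)

theorem exists_wedge_equiv
    {R : matchgateGroup n →* Matrix.specialOrthogonalGroup (Fin (2 * n)) ℝ}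
    (hR : ∀ U l, gateConj U (majorana l) =
      ∑ m, (((R U : Matrix (Fin (2 * n)) (Fin (2 * n)) ℝ) m l : ℝ) : ℂ) • majorana m) (i : ℕ) :
    ∃ φ : (exteriorPowerRep ((specialOrthogonalRep (2 * n)).comp R) i).Equiv
        (degreeRep n i).toRepresentation,
      ∀ (S : Finset (Fin (2 * n))) (hS : S.card = i),
        ((φ (exteriorPower.ιMulti ℂ i fun a => Pi.single (S.orderEmbOfFin hS a) 1) :
          (degreeRep n i).toSubmodule) : LiouvilleSpace n) = majoranaKet S := by
  let e : ⋀[ℂ]^i (Fin (2 * n) → ℂ) ≃ₗ[ℂ] degreeSpace n i :=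
    (LinearEquiv.ofInjective _ (wedgeToLiouville_injective i)).trans
      (LinearEquiv.ofEq _ _ (range_wedgeToLiouville i))
  refine ⟨Representation.Equiv.mk e fun U => ?_, fun S hS => wedgeToLiouville_single hS⟩
  refine LinearMap.ext fun x => ?_
  exact Subtype.ext (LinearMap.congr_fun (naturalRep_wedgeToLiouville hR i U) x).symm

theorem exists_hodge_equiv {i j : ℕ} (hij : i + j = 2 * n) :
    ∃ φ : (degreeRep n i).toRepresentation.Equiv (degreeRep n j).toRepresentation,
      ∀ (S : Finset (Fin (2 * n))) (v : (degreeRep n i).toSubmodule), S.card = i →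
        (v : LiouvilleSpace n) = majoranaKet S →
        ((φ v : (degreeRep n j).toSubmodule) : LiouvilleSpace n) =
          ((complementSign S : ℤ) : ℂ) • majoranaKet Sᶜ := by
  have hmem : ∀ {i j : ℕ}, i + j = 2 * n → ∀ v ∈ degreeSpace n i,
      rightParity n v ∈ degreeSpace n j := by
    intro i j hij v hv
    induction hv using Submodule.span_induction with
    | mem x hx =>
      obtain ⟨S, hS, rfl⟩ := hx
      rw [rightParity_majoranaKet]
      refine Submodule.smul_mem _ _ (majoranaKet_mem_degreeSpace ?_)
      rw [Finset.card_compl, hS, Fintype.card_fin]; omega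
    | zero => simp
    | add x y _ _ hx hy => rw [map_add]; exact Submodule.add_mem _ hx hy
    | smul a x _ hx => rw [map_smul]; exact Submodule.smul_mem _ _ hx
  set s : ℂ := ((revSign i : ℤ) : ℂ) with hs
  have hss : s * s = 1 := units_cast_mul_self _
  have hone : ((-1 : ℂ) ^ n) * (-1) ^ n = 1 := by rw [← mul_pow]; simp
  -- The scalar `s` removes the reversal sign of `rightParity` in degree `i`, leaving the Hodge
  -- star. The inverse carries an extra `(-1)^n` because `rightParity` squares to `(-1)^n`.
  let e : degreeSpace n i ≃ₗ[ℂ] degreeSpace n j := LinearEquiv.ofLinearMap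
    ((s • rightParity n).restrict fun v hv => Submodule.smul_mem _ s (hmem hij v hv))
    (((s * (-1) ^ n) • rightParity n).restrict fun v hv =>
      Submodule.smul_mem _ (s * (-1) ^ n) (hmem ((add_comm _ _).trans hij) v hv))
    (by
      ext1 v
      apply Subtype.ext
      simp only [LinearMap.comp_apply, LinearMap.coe_restrict_apply, LinearMap.smul_apply, map_smul,
        rightParity_rightParity, smul_smul, LinearMap.id_apply]
      rw [show s * (-1) ^ n * (s * (-1) ^ n) = 1 by
        linear_combination ((-1) ^ n * (-1) ^ n) * hss + hone, one_smul])
    (by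
      ext1 v
      apply Subtype.ext
      simp only [LinearMap.comp_apply, LinearMap.coe_restrict_apply, LinearMap.smul_apply, map_smul,
        rightParity_rightParity, smul_smul, LinearMap.id_apply]
      rw [show s * (s * (-1) ^ n * (-1) ^ n) = 1 by
        linear_combination ((-1) ^ n * (-1) ^ n) * hss + hone, one_smul])
  refine ⟨Representation.Equiv.mk e fun U => ?_, fun S v hS hv => ?_⟩
  · ext1 v
    apply Subtype.ext
    change s • rightParity n (naturalRep n U v) = naturalRep n U (s • rightParity n v)
    rw [map_smul, naturalRep_rightParity]
  · change s • rightParity n v = _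
    rw [hv, rightParity_majoranaKet, hS, smul_smul, ← hs, ← mul_assoc, hss, one_mul]

end ExteriorPowers

/-! ### The direct sum decomposition. -/

section Decomposition

variable {n : ℕ}

/-- An operator that acts on each of the summands as a scalar, with different scalars. -/
def labelOperator (n : ℕ) : Module.End ℂ (LiouvilleSpace n) :=
  (majoranaBasis n).constr ℂ fun S =>
    if S.card = n then (n : ℂ) • majoranaKet S + (1 / 4 : ℂ) • chirality n (majoranaKet S)
    else (S.card : ℂ) • majoranaKet S

theorem labelOperator_majoranaKet (S : Finset (Fin (2 * n))) : labelOperator n (majoranaKet S) =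
    if S.card = n then (n : ℂ) • majoranaKet S + (1 / 4 : ℂ) • chirality n (majoranaKet S)
    else (S.card : ℂ) • majoranaKet S := by
  rw [labelOperator, ← majoranaBasis_apply, Module.Basis.constr_basis, majoranaBasis_apply]

theorem labelOperator_of_mem_middle {v : LiouvilleSpace n} (hv : v ∈ degreeSpace n n) :
    labelOperator n v = (n : ℂ) • v + (1 / 4 : ℂ) • chirality n v := by
  induction hv using Submodule.span_induction with
  | mem x hx =>
    obtain ⟨S, hS, rfl⟩ := hx
    rw [labelOperator_majoranaKet, if_pos hS]
  | zero => simp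
  | add x y _ _ hx hy => rw [map_add, map_add, hx, hy]; module
  | smul a x _ hx => rw [map_smul, map_smul, hx]; module

/-- The eigenvalues of `labelOperator`. -/
def labelEigenvalue (n : ℕ) : IrrepLabel n → ℂ :=
  Sum.elim (fun i => ((i : Fin (2 * n + 1)) : ℕ)) fun ε => n + ((ε : ℤ) : ℂ) / 4

/-- The halves get the non-integral values `n ± 1/4`, which cannot collide with a degree;
multiplying by `4` moves the comparison to the integers. -/
theorem labelEigenvalue_injective : Function.Injective (labelEigenvalue n) := by
  have hne : ∀ (i : {i : Fin (2 * n + 1) // (i : ℕ) ≠ n}) (ε : ℤˣ),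
      labelEigenvalue n (Sum.inl i) ≠ labelEigenvalue n (Sum.inr ε) := by
    intro i ε h
    simp only [labelEigenvalue, Sum.elim_inl, Sum.elim_inr] at h
    have h' : (4 * (((i : Fin (2 * n + 1)) : ℕ) : ℤ) : ℂ) = ((4 * (n : ℤ) + (ε : ℤ) : ℤ) : ℂ) := by
      push_cast
      rw [h]
      ring
    have h'' : 4 * (((i : Fin (2 * n + 1)) : ℕ) : ℤ) = 4 * (n : ℤ) + (ε : ℤ) := by exact_mod_cast h'
    rcases Int.units_eq_one_or ε with rfl | rfl <;> simp at h'' <;> omega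
  rintro (i | ε) (j | ε') h
  · simp only [labelEigenvalue, Sum.elim_inl] at h
    have h' := Nat.cast_injective h
    rw [Subtype.ext (Fin.ext h')]
  · exact (hne _ _ h).elim
  · exact (hne _ _ h.symm).elim
  · simp only [labelEigenvalue, Sum.elim_inr] at h
    have h' : ((ε : ℤ) : ℂ) = ((ε' : ℤ) : ℂ) := by linear_combination 4 * h
    rw [Units.ext (Int.cast_injective h')]

theorem irrep_le_eigenspace (a : IrrepLabel n) :
    (irrep n a).toSubmodule ≤ (labelOperator n).eigenspace (labelEigenvalue n a) := by
  rcases a with i | ε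
  · refine Submodule.span_le.2 ?_
    rintro _ ⟨S, hS, rfl⟩
    rw [SetLike.mem_coe, Module.End.mem_eigenspace_iff, labelOperator_majoranaKet,
      if_neg (hS ▸ i.2), hS]
    rfl
  · intro v hv
    obtain ⟨h1, h2⟩ := mem_halfSpace.1 hv
    rw [Module.End.mem_eigenspace_iff, labelOperator_of_mem_middle h1, h2, smul_smul, ← add_smul]
    congr 1
    simp only [labelEigenvalue, Sum.elim_inr]
    ring

/-- Eigenspaces of one operator for distinct eigenvalues are independent, and the summands together
contain every Majorana monomial. -/
theorem irrep_isInternal (n : ℕ) : DirectSum.IsInternal fun a => (irrep n a).toSubmodule := by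
  rw [DirectSum.isInternal_submodule_iff_iSupIndep_and_iSup_eq_top]
  refine ⟨((labelOperator n).eigenspaces_iSupIndep.comp labelEigenvalue_injective).mono
    irrep_le_eigenspace, ?_⟩
  rw [eq_top_iff, ← (majoranaBasis n).span_eq, Submodule.span_le]
  rintro _ ⟨S, rfl⟩
  rw [majoranaBasis_apply, SetLike.mem_coe]
  by_cases hS : S.card = n
  · have h := majoranaKet_mem_degreeSpace hS
    rw [← halfSpace_sup] at h
    exact sup_le (le_iSup (fun a => (irrep n a).toSubmodule) (Sum.inr 1))
      (le_iSup (fun a => (irrep n a).toSubmodule) (Sum.inr (-1))) h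
  · have hlt : S.card < 2 * n + 1 := by
      have := S.card_le_univ
      rw [Fintype.card_fin] at this
      omega
    exact le_iSup (fun a => (irrep n a).toSubmodule) (Sum.inl ⟨⟨S.card, hlt⟩, hS⟩)
      (majoranaKet_mem_degreeSpace rfl)

end Decomposition

/-! ### Signed permutations of the Majorana operators inside the group. -/

section SignedPermutations

variable {n : ℕ}

theorem onQubits_mul {k k' : Fin n} (hk : k ≠ k')
    (M N : Matrix (Fin 2 × Fin 2) (Fin 2 × Fin 2) ℂ) :
    onQubits k k' M * onQubits k k' N = onQubits k k' (M * N) := by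
  ext x y
  rw [Matrix.mul_apply]
  by_cases hxy : ∀ j, j ≠ k → j ≠ k' → x j = y j
  · rw [onQubits, onQubits, onQubits, Matrix.of_apply, if_pos hxy, Matrix.mul_apply]
    symm
    refine Finset.sum_of_injOn
      (fun p : Fin 2 × Fin 2 => Function.update (Function.update x k p.1) k' p.2) ?_ ?_ ?_ ?_
    · intro p _ q _ h
      have h1 := congrFun h k
      have h2 := congrFun h k'
      simp [hk] at h1 h2
      exact Prod.ext h1 h2
    · simp
    · intro z _ hz
      rw [Matrix.of_apply, if_neg, zero_mul]
      intro h
      refine hz ⟨(z k, z k'), by simp, ?_⟩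
      funext j
      by_cases h1 : j = k'
      · subst h1; simp
      · by_cases h2 : j = k
        · subst h2; simp [h1]
        · simp [h1, h2, h j h2 h1]
    · intro p _
      have h1 : ∀ j, j ≠ k → j ≠ k' →
          x j = Function.update (Function.update x k p.1) k' p.2 j := by
        intro j h1 h2; simp [h1, h2]
      rw [Matrix.of_apply, Matrix.of_apply, if_pos h1,
        if_pos fun j h h' => (h1 j h h').symm.trans (hxy j h h')]
      simp [hk]
  · rw [onQubits, onQubits, onQubits, Matrix.of_apply, if_neg hxy]
    refine Finset.sum_eq_zero fun z _ => ?_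
    rw [Matrix.of_apply, Matrix.of_apply]
    by_cases h1 : ∀ j, j ≠ k → j ≠ k' → x j = z j
    · rw [if_neg fun h2 : ∀ j, j ≠ k → j ≠ k' → z j = y j =>
        hxy fun j h h' => (h1 j h h').trans (h2 j h h'), mul_zero]
    · rw [if_neg h1, zero_mul]

theorem onQubits_conjTranspose (k k' : Fin n) (M : Matrix (Fin 2 × Fin 2) (Fin 2 × Fin 2) ℂ) :
    (onQubits k k' M)ᴴ = onQubits k k' Mᴴ := by
  ext x y
  rw [Matrix.conjTranspose_apply, onQubits, onQubits, Matrix.of_apply, Matrix.of_apply]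
  simp only [eq_comm (a := x _), apply_ite star, star_zero, Matrix.conjTranspose_apply]

theorem onQubits_one (k k' : Fin n) : onQubits k k' 1 = 1 := by
  ext x y
  rw [onQubits, Matrix.of_apply, Matrix.one_apply, Matrix.one_apply]
  by_cases hxy : x = y
  · simp [hxy]
  · rw [if_neg hxy]
    split_ifs with h1 h2
    · refine absurd (funext fun j => ?_) hxy
      by_cases h : j = k
      · rw [h]; exact congrArg Prod.fst h2
      · by_cases h' : j = k'
        · rw [h']; exact congrArg Prod.snd h2
        · exact h1 j h h'
    · rfl
    · rfl

theorem exists_gate {k k' : Fin n} (hk : (k' : ℕ) = k + 1) {A B : Matrix (Fin 2) (Fin 2) ℂ}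
    (hA : A ∈ Matrix.specialUnitaryGroup (Fin 2) ℂ)
    (hB : B ∈ Matrix.specialUnitaryGroup (Fin 2) ℂ) :
    ∃ U : matchgateGroup n, gateOp U = onQubits k k' (matchgate A B) := by
  have hA' : A * Aᴴ = 1 := Matrix.mem_unitaryGroup_iff.1 hA.1
  have hB' : B * Bᴴ = 1 := Matrix.mem_unitaryGroup_iff.1 hB.1
  have hu : onQubits k k' (matchgate A B) ∈ Matrix.unitaryGroup (Fin n → Fin 2) ℂ := by
    rw [Matrix.mem_unitaryGroup_iff, Matrix.star_eq_conjTranspose, onQubits_conjTranspose,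
      onQubits_mul (fun h => by simp [h] at hk), matchgate_conjTranspose, matchgate_mul_matchgate,
      hA', hB', matchgate_one, onQubits_one]
  exact ⟨⟨⟨_, hu⟩, Subgroup.subset_closure ⟨k, k', hk, A, hA, B, hB, rfl⟩⟩, rfl⟩

theorem smul_mem_specialUnitaryGroup {A : Matrix (Fin 2) (Fin 2) ℂ} (h : A * Aᴴ = (2 : ℂ) • 1)
    (hd : A.det = 2) : (Real.sqrt 2 : ℂ)⁻¹ • A ∈ Matrix.specialUnitaryGroup (Fin 2) ℂ := by
  have h2 : (Real.sqrt 2 : ℂ)⁻¹ * (Real.sqrt 2 : ℂ)⁻¹ = 2⁻¹ := by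
    rw [← mul_inv, ← Complex.ofReal_mul, Real.mul_self_sqrt (by norm_num)]; simp
  rw [Matrix.mem_specialUnitaryGroup_iff, Matrix.mem_unitaryGroup_iff,
    Matrix.star_eq_conjTranspose, Matrix.conjTranspose_smul, Matrix.det_smul]
  constructor
  · rw [smul_mul_smul_comm, h, star_inv₀, Complex.star_def, Complex.conj_ofReal, h2, smul_smul]
    simp
  · rw [Fintype.card_fin, sq, h2, hd]; simp

/-- These are quarter turns in the planes of consecutive blocks. For the first two, `A = B` is
`exp(iπZ/4)` or `exp(iπX/4)`; for the third, `A = exp(iπZ/4)` and `B = A†`, which mixes `Z` with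
`-i`. -/
theorem exists_local_rotation (a : Fin 3) : ∃ A ∈ Matrix.specialUnitaryGroup (Fin 2) ℂ,
    ∃ B ∈ Matrix.specialUnitaryGroup (Fin 2) ℂ, ∀ j : Fin 4,
      A * localBlock j = ((if j = a.castSucc then -1 else 1 : ℝ) •
        localBlock (Equiv.swap a.castSucc a.succ j)) * B := by
  -- Scaling by `√2` gives Gaussian integer entries; the factor cancels between the two sides.
  suffices h : ∃ A B : Matrix (Fin 2) (Fin 2) ℂ, A * Aᴴ = (2 : ℂ) • 1 ∧ A.det = 2 ∧
      B * Bᴴ = (2 : ℂ) • 1 ∧ B.det = 2 ∧ ∀ j : Fin 4,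
      A * localBlock j = ((if j = a.castSucc then -1 else 1 : ℝ) •
        localBlock (Equiv.swap a.castSucc a.succ j)) * B by
    obtain ⟨A, B, hA, hA', hB, hB', h⟩ := h
    exact ⟨_, smul_mem_specialUnitaryGroup hA hA', _, smul_mem_specialUnitaryGroup hB hB',
      fun j => by rw [smul_mul_assoc, mul_smul_comm, h j]⟩
  have hI : (1 + Complex.I) * (1 - Complex.I) = 2 := by
    linear_combination -Complex.I_mul_I
  have hI' : (1 - Complex.I) * (1 + Complex.I) = 2 := by rw [mul_comm, hI]
  fin_cases a
  · refine ⟨!![1 + Complex.I, 0; 0, 1 - Complex.I], !![1 + Complex.I, 0; 0, 1 - Complex.I],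
      ?_, ?_, ?_, ?_, fun j => ?_⟩
    · ext i j
      fin_cases i <;> fin_cases j <;>
        simp [Matrix.mul_apply, Fin.sum_univ_two, ← sub_eq_add_neg, hI, hI']
    · simp [Matrix.det_fin_two, hI]
    · ext i j
      fin_cases i <;> fin_cases j <;>
        simp [Matrix.mul_apply, Fin.sum_univ_two, ← sub_eq_add_neg, hI, hI']
    · simp [Matrix.det_fin_two, hI]
    · fin_cases j <;>
      simp [Equiv.swap_apply_def, localBlock_zero, localBlock_one, localBlock_two,
        localBlock_three, pauliX, pauliY, pauliZ, Complex.ext_iff]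
  · refine ⟨!![1, Complex.I; Complex.I, 1], !![1, Complex.I; Complex.I, 1],
      ?_, ?_, ?_, ?_, fun j => ?_⟩
    · ext i j
      fin_cases i <;> fin_cases j <;>
        simp [Matrix.mul_apply, Fin.sum_univ_two, one_add_one_eq_two]
    · simp [Matrix.det_fin_two, one_add_one_eq_two]
    · ext i j
      fin_cases i <;> fin_cases j <;>
        simp [Matrix.mul_apply, Fin.sum_univ_two, one_add_one_eq_two]
    · simp [Matrix.det_fin_two, one_add_one_eq_two]
    · fin_cases j <;>
      simp [Equiv.swap_apply_def, localBlock_zero, localBlock_one, localBlock_two,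
        localBlock_three, pauliX, pauliY, pauliZ]
  · refine ⟨!![1 + Complex.I, 0; 0, 1 - Complex.I], !![1 - Complex.I, 0; 0, 1 + Complex.I],
      ?_, ?_, ?_, ?_, fun j => ?_⟩
    · ext i j
      fin_cases i <;> fin_cases j <;>
        simp [Matrix.mul_apply, Fin.sum_univ_two, ← sub_eq_add_neg, hI, hI']
    · simp [Matrix.det_fin_two, hI]
    · ext i j
      fin_cases i <;> fin_cases j <;>
        simp [Matrix.mul_apply, Fin.sum_univ_two, ← sub_eq_add_neg, hI, hI']
    · simp [Matrix.det_fin_two, hI']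
    · fin_cases j <;>
      simp [Equiv.swap_apply_def, localBlock_zero, localBlock_one, localBlock_two,
        localBlock_three, pauliX, pauliY, pauliZ, Complex.ext_iff]

theorem exists_adjacent_rotation {a a' : Fin (2 * n)} (haa' : (a' : ℕ) = a + 1) (hn : 2 ≤ n) :
    ∃ U : matchgateGroup n, ∀ l, gateConj U (majorana l) =
      (if l = a then -1 else 1 : ℤˣ) • majorana (Equiv.swap a a' l) := by
  -- Both indices must lie among the four Majorana operators of qubits `k, k + 1`. Normally `k = a /
  -- 2`; if `a` sits on the last qubit, the pair is shifted back by one and `a` is in position `2`.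
  obtain ⟨k, j₀, hk1, hj⟩ : ∃ (k : ℕ) (j₀ : Fin 3), k + 1 < n ∧ (a : ℕ) = 2 * k + j₀ := by
    by_cases h : (a : ℕ) / 2 + 1 < n
    · exact ⟨a / 2, ⟨a % 2, by omega⟩, h, by simp; omega⟩
    · exact ⟨a / 2 - 1, ⟨2, by omega⟩, by omega, by simp; omega⟩
  obtain ⟨A, hA, B, hB, hAB⟩ := exists_local_rotation j₀
  have hA' : Aᴴ * A = 1 := Matrix.mem_unitaryGroup_iff'.1 hA.1
  have hB' : B * Bᴴ = 1 := Matrix.mem_unitaryGroup_iff.1 hB.1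
  let k₀ : Fin n := ⟨k, by omega⟩
  let k₁ : Fin n := ⟨k + 1, hk1⟩
  have hk : (k₁ : ℕ) = k₀ + 1 := rfl
  obtain ⟨U, hU⟩ := exists_gate hk hA hB
  refine ⟨U, fun l => ?_⟩
  by_cases hl : (l : ℕ) / 2 = k₀ ∨ (l : ℕ) / 2 = k₁
  · obtain ⟨j, hlj⟩ : ∃ j : Fin 4, l = ⟨2 * k₀ + j, by simp only [k₀]; omega⟩ := by
      refine ⟨⟨l - 2 * k, ?_⟩, Fin.ext ?_⟩ <;> simp [k₀, k₁] at hl ⊢ <;> omega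
    have ha : a = ⟨2 * k₀ + (j₀.castSucc : Fin 4), by simp only [k₀]; omega⟩ := Fin.ext hj
    have ha' : a' = ⟨2 * k₀ + (j₀.succ : Fin 4), by simp only [k₀]; omega⟩ :=
      Fin.ext (by simp [k₀]; omega)
    have hinj : Function.Injective
        (fun i : Fin 4 => (⟨2 * k₀ + i, by simp only [k₀]; omega⟩ : Fin (2 * n))) := by
      intro i i' h
      simpa [Fin.ext_iff] using h
    have hsw := hinj.swap_apply j₀.castSucc j₀.succ j
    have hif : (l = a) ↔ j = j₀.castSucc := by
      rw [hlj, ha]; exact hinj.eq_iff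
    have hlocal := hAB j
    set t : ℝ := if j = j₀.castSucc then -1 else 1 with ht
    have h1 := onQubits_matchgate_mul_majorana hk (A := A) (B := B) (j := j)
      (r := fun i => if i = Equiv.swap j₀.castSucc j₀.succ j then t else 0)
      (by simpa [ite_smul] using hlocal)
      (by
        -- The lower block identity is the adjoint of the upper one, multiplied by `B` on the left
        -- and `A` on the right.
        have h2 := congrArg (fun M => B * Mᴴ * A) hlocal
        simp only [Matrix.conjTranspose_mul, mul_assoc, hA', mul_one] at h2
        simp only [← mul_assoc, hB', one_mul] at h2
        simpa [ite_smul] using h2)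
    simp only [ite_smul, zero_smul, Finset.sum_ite_eq', Finset.mem_univ, if_true] at h1
    rw [← hU, ← smul_mul_assoc] at h1
    have h3 := conj_eq_of_mul_eq U.1 h1
    have h4 : Equiv.swap a a' l =
        ⟨2 * k₀ + (Equiv.swap j₀.castSucc j₀.succ j : Fin 4), by simp only [k₀]; omega⟩ := by
      rw [hlj, ha, ha']; exact hsw
    rw [h4]
    conv_lhs => rw [hlj]
    refine h3.trans ?_
    simp only [hif, ht]
    split_ifs <;> simp
  · rw [not_or] at hl
    have hla : l ≠ a := by
      rintro rfl
      simp [k₀, k₁] at hl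
      omega
    have hla' : l ≠ a' := by
      rintro rfl
      simp [k₀, k₁] at hl
      omega
    rw [if_neg hla, one_smul, Equiv.swap_apply_of_ne_of_ne hla hla']
    refine conj_eq_of_mul_eq U.1 ?_
    change gateOp U * _ = _ * gateOp U
    rw [hU, onQubits_matchgate_comm_majorana hk A B hl.1 hl.2]

theorem mem_closure_adjacent_swaps {N : ℕ} (π : Equiv.Perm (Fin N)) :
    π ∈ Submonoid.closure {τ | ∃ a a' : Fin N, (a' : ℕ) = a + 1 ∧ τ = Equiv.swap a a'} := by
  cases N with
  | zero => rw [Subsingleton.elim π 1]; exact one_mem _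
  | succ N =>
    have h : π ∈ Submonoid.closure (Set.range fun i : Fin N => Equiv.swap i.castSucc i.succ) := by
      rw [Equiv.Perm.mclosure_swap_castSucc_succ]; trivial
    refine Submonoid.closure_mono ?_ h
    rintro _ ⟨i, rfl⟩
    exact ⟨_, _, by simp, rfl⟩

/-- The quarter turns realize the adjacent transpositions up to sign, these generate all
permutations, and the signs multiply under composition. -/
theorem exists_signed_permutation (hn : 2 ≤ n) (π : Equiv.Perm (Fin (2 * n))) :
    ∃ (U : matchgateGroup n) (s : Fin (2 * n) → ℤˣ),
      ∀ l, gateConj U (majorana l) = s l • majorana (π l) := by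
  induction mem_closure_adjacent_swaps π using Submonoid.closure_induction with
  | mem τ h =>
    obtain ⟨a, a', haa', rfl⟩ := h
    obtain ⟨U, hU⟩ := exists_adjacent_rotation haa' hn
    exact ⟨U, _, hU⟩
  | one => exact ⟨1, 1, fun l => by simp [gateConj_one]⟩
  | mul σ τ _ _ hσ hτ =>
    obtain ⟨U, s, hU⟩ := hσ
    obtain ⟨V, t, hV⟩ := hτ
    refine ⟨U * V, fun l => t l * s (τ l), fun l => ?_⟩
    rw [gateConj_mul, hV, units_smul_eq, map_smul, hU, ← units_smul_eq, smul_smul]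
    rfl

theorem gateConj_orderedProd (U : matchgateGroup n) (S : Finset (Fin (2 * n))) :
    gateConj U (orderedProd majorana S) = orderedProd (fun a => gateConj U (majorana a)) S := by
  rw [orderedProd, orderedProd, map_list_prod, List.map_map]
  rfl

theorem naturalRep_majoranaKet (U : matchgateGroup n) (S : Finset (Fin (2 * n))) :
    naturalRep n U (majoranaKet S) = ((Real.sqrt 2 : ℂ) ^ n)⁻¹ •
      liouvilleEquiv n (orderedProd (fun a => gateConj U (majorana a)) S) := by
  rw [majoranaKet_eq, map_smul, naturalRep_liouvilleEquiv, gateConj_orderedProd]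

theorem exists_naturalRep_majoranaKet_eq (hn : 2 ≤ n) {S T : Finset (Fin (2 * n))}
    (h : S.card = T.card) : ∃ (U : matchgateGroup n) (t : ℤˣ),
      naturalRep n U (majoranaKet S) = ((t : ℤ) : ℂ) • majoranaKet T := by
  let π : Equiv.Perm (Fin (2 * n)) := (Finset.equivOfCardEq h).extendSubtype
  have hπ : S.image π = T := by
    refine Finset.eq_of_subset_of_card_le ?_ ?_
    · intro x hx
      obtain ⟨y, hy, rfl⟩ := Finset.mem_image.1 hx
      exact Equiv.extendSubtype_mem _ y hy
    · rw [Finset.card_image_of_injective _ π.injective, h]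
  obtain ⟨U, s, hU⟩ := exists_signed_permutation hn π
  obtain ⟨t, ht⟩ := orderedProd_smul_comp_perm (majorana_anticomm (n := n)) s π S
  refine ⟨U, t, ?_⟩
  rw [naturalRep_majoranaKet]
  simp only [hU]
  rw [ht, hπ, units_smul_eq, map_smul, majoranaKet_eq, smul_comm]

/-- The sign by which the Majorana monomial of `S` changes when `c_a` and `c_{a'}` are negated. -/
def pairSign (a a' : Fin (2 * n)) (S : Finset (Fin (2 * n))) : ℤˣ :=
  (if a ∈ S then -1 else 1) * (if a' ∈ S then -1 else 1)

/-- The square of the quarter turn is a half turn, which negates `c_a` and `c_{a'}` and fixes the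
rest. -/
theorem exists_naturalRep_eq_pairSign (hn : 2 ≤ n) {a a' : Fin (2 * n)} (haa' : (a' : ℕ) = a + 1) :
    ∃ U : matchgateGroup n, ∀ S,
      naturalRep n U (majoranaKet S) = ((pairSign a a' S : ℤ) : ℂ) • majoranaKet S := by
  obtain ⟨U, hU⟩ := exists_adjacent_rotation haa' hn
  have hne : a ≠ a' := fun h => by rw [h] at haa'; omega
  have hUU : ∀ l, gateConj (U * U) (majorana l) =
      ((if l = a then -1 else 1 : ℤˣ) * (if l = a' then -1 else 1)) • majorana l := by
    intro l
    rw [gateConj_mul, hU, units_smul_eq, map_smul, hU, ← units_smul_eq, smul_smul,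
      Equiv.swap_apply_self]
    congr 2
    by_cases h : l = a
    · subst h; simp [hne, hne.symm]
    · by_cases h' : l = a'
      · subst h'; simp
      · simp [Equiv.swap_apply_of_ne_of_ne h h', h, h']
  refine ⟨U * U, fun S => ?_⟩
  rw [naturalRep_majoranaKet]
  simp only [hUU]
  rw [orderedProd_smul, units_smul_eq, map_smul, majoranaKet_eq, smul_comm, Finset.prod_mul_distrib,
    Finset.prod_ite_eq', Finset.prod_ite_eq']
  rfl

/-- Equality of the signs for `a, a + 1` says that `S` and `T` agree at `a` exactly when they agree
at `a + 1`, so they agree everywhere or nowhere. -/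
theorem eq_or_eq_compl_of_pairSign {S T : Finset (Fin (2 * n))}
    (h : ∀ a a' : Fin (2 * n), (a' : ℕ) = a + 1 → pairSign a a' S = pairSign a a' T) :
    T = S ∨ T = Sᶜ := by
  rcases Nat.eq_zero_or_pos n with rfl | hn
  · exact Or.inl (Finset.ext fun x => (Fin.elim0 (by simpa using x)))
  have hstep : ∀ m : ℕ, ∀ hm : m < 2 * n,
      ((⟨m, hm⟩ : Fin (2 * n)) ∈ S ↔ (⟨m, hm⟩ : Fin (2 * n)) ∈ T) ↔
      ((⟨0, by omega⟩ : Fin (2 * n)) ∈ S ↔ (⟨0, by omega⟩ : Fin (2 * n)) ∈ T) := by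
    intro m
    induction m with
    | zero => intro _; rfl
    | succ m ih =>
      intro hm
      rw [← ih (by omega)]
      have := h ⟨m, by omega⟩ ⟨m + 1, hm⟩ rfl
      unfold pairSign at this
      by_cases h1 : (⟨m, by omega⟩ : Fin (2 * n)) ∈ S <;>
      by_cases h2 : (⟨m, by omega⟩ : Fin (2 * n)) ∈ T <;>
      by_cases h3 : (⟨m + 1, hm⟩ : Fin (2 * n)) ∈ S <;>
      by_cases h4 : (⟨m + 1, hm⟩ : Fin (2 * n)) ∈ T <;>
      simp [h1, h2, h3, h4] at this ⊢
  by_cases h0 : (⟨0, by omega⟩ : Fin (2 * n)) ∈ S ↔ (⟨0, by omega⟩ : Fin (2 * n)) ∈ T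
  · left
    ext x
    exact ((hstep x x.2).2 h0).symm
  · right
    ext x
    have := mt (hstep x x.2).1 h0
    rw [Finset.mem_compl]
    simp only [Fin.eta] at this
    tauto

end SignedPermutations

/-! ### Irreducibility of the summands. -/

section Irreducibility

variable {n : ℕ}

theorem isIrreducible_toRepresentation {G V : Type*} [Group G] [AddCommGroup V] [Module ℂ V]
    {ρ : Representation ℂ G V} (V₀ : Subrepresentation ρ) (hne : ∃ v ∈ V₀.toSubmodule, v ≠ 0)
    (h : ∀ W : Submodule ℂ V, W ≤ V₀.toSubmodule → (∀ g, ∀ v ∈ W, ρ g v ∈ W) →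
      (∃ w ∈ W, w ≠ 0) → V₀.toSubmodule ≤ W) :
    V₀.toRepresentation.IsIrreducible := by
  obtain ⟨v, hv, hv0⟩ := hne
  have : Nontrivial (Subrepresentation V₀.toRepresentation) := by
    refine ⟨⊥, ⊤, fun heq => hv0 ?_⟩
    have : (⟨v, hv⟩ : V₀.toSubmodule) ∈ (⊥ : Subrepresentation V₀.toRepresentation).toSubmodule :=
      heq ▸ (Submodule.mem_top : (⟨v, hv⟩ : V₀.toSubmodule) ∈ (⊤ : Submodule ℂ V₀.toSubmodule))
    exact congrArg Subtype.val ((Submodule.mem_bot ℂ).1 this)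
  refine ⟨fun W => ?_⟩
  by_cases hW : ∃ w ∈ W.toSubmodule, w ≠ 0
  · right
    obtain ⟨w, hw, hw0⟩ := hW
    have hle := h (W.toSubmodule.map V₀.toSubmodule.subtype) (Submodule.map_subtype_le _ _)
      (by
        rintro g _ ⟨x, hx, rfl⟩
        exact ⟨_, W.apply_mem_toSubmodule g hx, rfl⟩)
      ⟨w, ⟨w, hw, rfl⟩, fun h0 => hw0 (Subtype.ext h0)⟩
    refine Subrepresentation.toSubmodule_injective (eq_top_iff.2 fun x _ => ?_)
    obtain ⟨y, hy, hyx⟩ := hle x.2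
    rwa [← Subtype.ext hyx]
  · left
    push Not at hW
    exact Subrepresentation.toSubmodule_injective (eq_bot_iff.2 fun x hx =>
      (Submodule.mem_bot ℂ).2 (hW x hx))

theorem finset_compl_ne_self (hn : 0 < n) (S : Finset (Fin (2 * n))) : Sᶜ ≠ S := by
  intro h
  have := Finset.mem_compl (s := S) (a := ⟨0, by omega⟩)
  rw [h] at this
  tauto

theorem repr_naturalRep_of_pairSign {U : matchgateGroup n} {a a' : Fin (2 * n)}
    (hU : ∀ S, naturalRep n U (majoranaKet S) = ((pairSign a a' S : ℤ) : ℂ) • majoranaKet S)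
    (v : LiouvilleSpace n) (T : Finset (Fin (2 * n))) :
    (majoranaBasis n).repr (naturalRep n U v) T =
      ((pairSign a a' T : ℤ) : ℂ) * (majoranaBasis n).repr v T := by
  have h : (majoranaBasis n).coord T ∘ₗ naturalRep n U =
      ((pairSign a a' T : ℤ) : ℂ) • (majoranaBasis n).coord T := by
    refine (majoranaBasis n).ext fun S => ?_
    rw [LinearMap.comp_apply, majoranaBasis_apply, hU]
    by_cases hST : S = T
    · subst hST; simp [repr_majoranaKet]
    · simp [repr_majoranaKet, hST]
  exact LinearMap.congr_fun h v

/-- An invariant subspace contains the joint eigencomponents of its elements. -/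
theorem component_mem (hn : 2 ≤ n) {W : Submodule ℂ (LiouvilleSpace n)}
    (hW : ∀ U, ∀ v ∈ W, naturalRep n U v ∈ W) {w : LiouvilleSpace n} (hw : w ∈ W)
    (S : Finset (Fin (2 * n))) :
    (majoranaBasis n).repr w S • majoranaKet S + (majoranaBasis n).repr w Sᶜ • majoranaKet Sᶜ
      ∈ W := by
  let A := {p : Fin (2 * n) × Fin (2 * n) // (p.2 : ℕ) = p.1 + 1}
  -- The joint eigenprojection is built one adjacent pair at a time: averaging `v` with its
  -- sign-corrected image under the half turn removes the monomials of the wrong sign.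
  have hF : ∀ F : Finset A, ∃ v ∈ W, ∀ T, (majoranaBasis n).repr v T =
      if ∀ p ∈ F, pairSign p.1.1 p.1.2 T = pairSign p.1.1 p.1.2 S then
        (majoranaBasis n).repr w T else 0 := by
    intro F
    induction F using Finset.induction_on with
    | empty => exact ⟨w, hw, by simp⟩
    | insert p F _ ih =>
      obtain ⟨v, hv, hvT⟩ := ih
      obtain ⟨U, hU⟩ := exists_naturalRep_eq_pairSign hn p.2
      refine ⟨(1 / 2 : ℂ) • (v + ((pairSign p.1.1 p.1.2 S : ℤ) : ℂ) • naturalRep n U v),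
        Submodule.smul_mem _ _ (Submodule.add_mem _ hv (Submodule.smul_mem _ _ (hW U v hv))),
        fun T => ?_⟩
      simp only [map_smul, map_add, Finsupp.smul_apply, Finsupp.add_apply,
        repr_naturalRep_of_pairSign hU, hvT, smul_eq_mul, Finset.forall_mem_insert]
      clear hvT
      by_cases h1 : ∀ p ∈ F, pairSign p.1.1 p.1.2 T = pairSign p.1.1 p.1.2 S
      · rcases Int.units_eq_one_or (pairSign p.1.1 p.1.2 T) with h2 | h2 <;>
        rcases Int.units_eq_one_or (pairSign p.1.1 p.1.2 S) with h3 | h3 <;>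
          simp only [h2, h3] at h1 ⊢ <;> simp only [if_pos h1, true_and] <;> norm_num <;> ring
      · rw [if_neg h1, if_neg (fun h => h1 h.2)]; ring
  obtain ⟨v, hv, hvT⟩ := hF Finset.univ
  have hne : S ≠ Sᶜ := (finset_compl_ne_self (by omega) S).symm
  convert hv using 1
  refine (majoranaBasis n).ext_elem fun T => ?_
  rw [hvT]
  simp only [map_add, map_smul, repr_majoranaKet, Finsupp.add_apply, Finsupp.smul_apply,
    smul_eq_mul]
  by_cases hT : T = S ∨ T = Sᶜ
  · have hcond : ∀ p ∈ (Finset.univ : Finset A),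
        pairSign p.1.1 p.1.2 T = pairSign p.1.1 p.1.2 S := by
      intro p _
      rcases hT with rfl | rfl
      · rfl
      · unfold pairSign
        by_cases h1 : p.1.1 ∈ S <;> by_cases h2 : p.1.2 ∈ S <;> simp [h1, h2]
    rw [if_pos hcond]
    rcases hT with rfl | rfl
    · simp [hne.symm]
    · simp [hne]
  · rw [if_neg (fun h => hT (Or.inl h.symm)), if_neg (fun h => hT (Or.inr h.symm)), if_neg]
    · simp
    · intro h
      exact hT (eq_or_eq_compl_of_pairSign fun a a' h' =>
        (h ⟨(a, a'), h'⟩ (Finset.mem_univ _)).symm)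

/-- For `i ≠ n` the complement has another degree, so the component at `S` is a multiple of one
monomial, whose orbit reaches up to sign all monomials of degree `i`. -/
theorem degreeRep_isIrreducible (hn : 2 ≤ n) {i : ℕ} (hi : i ≤ 2 * n) (hin : i ≠ n) :
    (degreeRep n i).toRepresentation.IsIrreducible := by
  refine isIrreducible_toRepresentation _ ?_ fun W hWV hW hne => ?_
  · obtain ⟨S, -, hS⟩ := Finset.exists_subset_card_eq
      (s := (Finset.univ : Finset (Fin (2 * n)))) (by simpa using hi)
    refine ⟨majoranaKet S, majoranaKet_mem_degreeSpace hS, ?_⟩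
    rw [← majoranaBasis_apply]
    exact (majoranaBasis n).ne_zero S
  · obtain ⟨w, hw, hw0⟩ := hne
    obtain ⟨S, hS⟩ := Finsupp.ne_iff.1 (mt (LinearEquiv.map_eq_zero_iff _).1 hw0 :
      (majoranaBasis n).repr w ≠ 0)
    rw [Finsupp.zero_apply] at hS
    have hcard := mem_degreeSpace.1 (hWV hw) S hS
    have hc : (majoranaBasis n).repr w Sᶜ = 0 := by
      by_contra h
      have := mem_degreeSpace.1 (hWV hw) Sᶜ h
      rw [Finset.card_compl, Fintype.card_fin] at this
      omega
    have hket := component_mem hn hW hw S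
    rw [hc, zero_smul, add_zero, Submodule.smul_mem_iff _ hS] at hket
    refine Submodule.span_le.2 ?_
    rintro _ ⟨T, hT, rfl⟩
    obtain ⟨U, t, hU⟩ := exists_naturalRep_majoranaKet_eq hn (hcard.trans hT.symm)
    have := hW U _ hket
    rwa [hU, Submodule.smul_mem_iff _ (units_cast_ne_zero t)] at this

/-- The spanning vectors of `H_{n,1}` and `H_{n,2}`. -/
def halfVec (ε : ℤˣ) (S : Finset (Fin (2 * n))) : LiouvilleSpace n :=
  majoranaKet S + ((ε : ℤ) : ℂ) • chirality n (majoranaKet S)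

theorem halfSpace_eq_span (ε : ℤˣ) :
    halfSpace n ε = Submodule.span ℂ {v | ∃ S : Finset (Fin (2 * n)), S.card = n ∧
      v = halfVec ε S} := by
  rw [halfSpace]
  congr 1
  ext v
  refine exists_congr fun S => and_congr_right fun hS => ?_
  rw [halfVec, chirality_majoranaKet hS, smul_smul, mul_assoc]

theorem halfVec_mem {ε : ℤˣ} {S : Finset (Fin (2 * n))} (hS : S.card = n) :
    halfVec ε S ∈ halfSpace n ε := by
  rw [halfSpace_eq_span]
  exact Submodule.subset_span ⟨S, hS, rfl⟩

theorem halfVec_ne_zero (hn : 0 < n) {ε : ℤˣ} {S : Finset (Fin (2 * n))} (hS : S.card = n) :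
    halfVec ε S ≠ 0 := by
  intro h
  have := congrArg (fun v => (majoranaBasis n).repr v S) h
  simp [halfVec, chirality_majoranaKet hS, repr_majoranaKet,
    finset_compl_ne_self hn S] at this

theorem naturalRep_halfVec {U : matchgateGroup n} {S T : Finset (Fin (2 * n))} {t : ℂ}
    (h : naturalRep n U (majoranaKet S) = t • majoranaKet T) (ε : ℤˣ) :
    naturalRep n U (halfVec ε S) = t • halfVec ε T := by
  rw [halfVec, map_add, map_smul, naturalRep_chirality, h, map_smul, halfVec]
  module

theorem halfVec_compl {ε : ℤˣ} {S : Finset (Fin (2 * n))} (hS : S.card = n) :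
    (Complex.I ^ n * ((complementSign S : ℤ) : ℂ)) • halfVec ε Sᶜ =
      ((ε : ℤ) : ℂ) • halfVec ε S := by
  rw [halfVec, smul_add, smul_comm _ ((ε : ℤ) : ℂ), ← map_smul, ← chirality_majoranaKet hS,
    chirality_chirality, halfVec, smul_add, smul_smul ((ε : ℤ) : ℂ) ((ε : ℤ) : ℂ),
    units_cast_mul_self, one_smul, add_comm]

/-- Projecting onto the half space fixes the vector and expresses it through `halfVec ε S` and
`halfVec ε Sᶜ`, which are proportional because chirality exchanges `S` and `Sᶜ` up to a scalar. -/
theorem eq_smul_halfVec {ε : ℤˣ} {S : Finset (Fin (2 * n))} (hS : S.card = n) {x y : ℂ}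
    (h : x • majoranaKet S + y • majoranaKet Sᶜ ∈ halfSpace n ε) :
    ∃ z : ℂ, x • majoranaKet S + y • majoranaKet Sᶜ = z • halfVec ε S := by
  set v := x • majoranaKet S + y • majoranaKet Sᶜ with hv
  have h1 : v = (1 / 2 : ℂ) • (v + ((ε : ℤ) : ℂ) • chirality n v) := by
    rw [(mem_halfSpace.1 h).2, smul_smul, units_cast_mul_self, one_smul]
    module
  have h2 : v + ((ε : ℤ) : ℂ) • chirality n v = x • halfVec ε S + y • halfVec ε Sᶜ := by
    rw [hv, map_add, map_smul, map_smul, halfVec, halfVec]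
    module
  set κ := Complex.I ^ n * ((complementSign S : ℤ) : ℂ) with hκ
  have hκ0 : κ ≠ 0 := mul_ne_zero (pow_ne_zero _ Complex.I_ne_zero) (units_cast_ne_zero _)
  have h3 : halfVec ε Sᶜ = (κ⁻¹ * ((ε : ℤ) : ℂ)) • halfVec ε S := by
    rw [mul_smul, ← halfVec_compl hS, ← hκ, smul_smul, inv_mul_cancel₀ hκ0, one_smul]
  refine ⟨(1 / 2 : ℂ) * (x + y * (κ⁻¹ * ((ε : ℤ) : ℂ))), ?_⟩
  rw [h1, h2, h3]
  module

theorem halfRep_isIrreducible (hn : 2 ≤ n) (ε : ℤˣ) :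
    (halfRep n ε).toRepresentation.IsIrreducible := by
  refine isIrreducible_toRepresentation _ ?_ fun W hWV hW hne => ?_
  · obtain ⟨S, -, hS⟩ := Finset.exists_subset_card_eq
      (s := (Finset.univ : Finset (Fin (2 * n)))) (n := n) (by simp; omega)
    exact ⟨halfVec ε S, halfVec_mem hS, halfVec_ne_zero (by omega) hS⟩
  · obtain ⟨w, hw, hw0⟩ := hne
    obtain ⟨S, hS⟩ := Finsupp.ne_iff.1 (mt (LinearEquiv.map_eq_zero_iff _).1 hw0 :
      (majoranaBasis n).repr w ≠ 0)
    rw [Finsupp.zero_apply] at hS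
    have hcard := mem_degreeSpace.1 (mem_halfSpace.1 (hWV hw)).1 S hS
    have hket := component_mem hn hW hw S
    obtain ⟨z, hz⟩ := eq_smul_halfVec hcard (hWV hket)
    have hz0 : z ≠ 0 := by
      rintro rfl
      have := congrArg (fun v => (majoranaBasis n).repr v S) hz
      simp [repr_majoranaKet, finset_compl_ne_self (by omega : 0 < n) S] at this
      exact hS this
    rw [hz, Submodule.smul_mem_iff _ hz0] at hket
    change halfSpace n ε ≤ W
    rw [halfSpace_eq_span]
    refine Submodule.span_le.2 ?_
    rintro _ ⟨T, hT, rfl⟩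
    obtain ⟨U, t, hU⟩ := exists_naturalRep_majoranaKet_eq hn (hcard.trans hT.symm)
    have := hW U _ hket
    rwa [naturalRep_halfVec hU, Submodule.smul_mem_iff _ (units_cast_ne_zero t)] at this

theorem irrep_isIrreducible (hn : 2 ≤ n) (a : IrrepLabel n) :
    (irrep n a).toRepresentation.IsIrreducible := by
  rcases a with i | ε
  · exact degreeRep_isIrreducible hn (Nat.lt_succ_iff.1 i.1.2) i.2
  · exact halfRep_isIrreducible hn ε

end Irreducibility

/-! ### Isomorphisms between the summands. -/

section Isomorphisms

variable {n : ℕ}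

theorem equiv_apply_coe {V V' : Subrepresentation (naturalRep n)}
    (φ : V.toRepresentation.Equiv V'.toRepresentation) (U : matchgateGroup n) (v : V.toSubmodule) :
    ((φ ⟨naturalRep n U v, V.apply_mem_toSubmodule U v.2⟩ : V'.toSubmodule) : LiouvilleSpace n) =
      naturalRep n U (φ v : V'.toSubmodule) :=
  congrArg Subtype.val
    (Representation.IntertwiningMap.isIntertwining _ _ φ.toIntertwiningMap U v)

/-- An equivalence between subrepresentations preserves the joint eigenspaces. -/
theorem equiv_apply_eq (hn : 2 ≤ n) {V V' : Subrepresentation (naturalRep n)}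
    (φ : V.toRepresentation.Equiv V'.toRepresentation) {S : Finset (Fin (2 * n))} {x y : ℂ}
    {v : V.toSubmodule} (hv : (v : LiouvilleSpace n) = x • majoranaKet S + y • majoranaKet Sᶜ)
    {T : Finset (Fin (2 * n))}
    (hT : (majoranaBasis n).repr (φ v : V'.toSubmodule) T ≠ 0) : T = S ∨ T = Sᶜ := by
  refine eq_or_eq_compl_of_pairSign fun a a' haa' => ?_
  obtain ⟨U, hU⟩ := exists_naturalRep_eq_pairSign hn haa'
  have hSc : pairSign a a' Sᶜ = pairSign a a' S := by
    unfold pairSign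
    by_cases h1 : a ∈ S <;> by_cases h2 : a' ∈ S <;> simp [h1, h2]
  have h1 : (⟨naturalRep n U v, V.apply_mem_toSubmodule U v.2⟩ : V.toSubmodule) =
      ((pairSign a a' S : ℤ) : ℂ) • v := by
    apply Subtype.ext
    simp only [Submodule.coe_smul, hv, map_add, map_smul, hU, hSc]
    module
  have h2 := equiv_apply_coe φ U v
  rw [h1, map_smul, Submodule.coe_smul] at h2
  have h3 := congrArg (fun u => (majoranaBasis n).repr u T) h2
  simp only [map_smul, Finsupp.smul_apply, smul_eq_mul, repr_naturalRep_of_pairSign hU] at h3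
  exact Units.ext (Int.cast_injective (mul_right_cancel₀ hT h3))

theorem equiv_apply_expansion (hn : 2 ≤ n) {V V' : Subrepresentation (naturalRep n)}
    (φ : V.toRepresentation.Equiv V'.toRepresentation) {S : Finset (Fin (2 * n))} {x y : ℂ}
    {v : V.toSubmodule} (hv : (v : LiouvilleSpace n) = x • majoranaKet S + y • majoranaKet Sᶜ) :
    ∃ x' y' : ℂ, ((φ v : V'.toSubmodule) : LiouvilleSpace n) =
      x' • majoranaKet S + y' • majoranaKet Sᶜ := by
  refine ⟨(majoranaBasis n).repr (φ v : V'.toSubmodule) S,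
    (majoranaBasis n).repr (φ v : V'.toSubmodule) Sᶜ, (majoranaBasis n).ext_elem fun T => ?_⟩
  simp only [map_add, map_smul, repr_majoranaKet, Finsupp.add_apply, Finsupp.smul_apply,
    smul_eq_mul]
  have hne := finset_compl_ne_self (by omega : 0 < n) S
  by_cases hT : (majoranaBasis n).repr (φ v : V'.toSubmodule) T = 0
  · rw [hT]
    by_cases h1 : S = T
    · subst h1; simp [hT, hne]
    · by_cases h2 : Sᶜ = T
      · subst h2; simp [hT, hne.symm]
      · simp [h1, h2]
  · rcases equiv_apply_eq hn φ hv hT with rfl | rfl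
    · simp [hne]
    · simp [hne.symm]

/-- The degree of a summand. -/
def labelDegree (n : ℕ) : IrrepLabel n → ℕ := Sum.elim (fun i => ((i : Fin (2 * n + 1)) : ℕ)) fun _ => n

theorem irrep_le_degreeSpace (a : IrrepLabel n) :
    (irrep n a).toSubmodule ≤ degreeSpace n (labelDegree n a) := by
  rcases a with i | ε
  · exact le_rfl
  · exact fun v hv => (mem_halfSpace.1 hv).1

theorem exists_weight_vector (hn : 2 ≤ n) (a : IrrepLabel n) :
    ∃ (S : Finset (Fin (2 * n))) (x y : ℂ), S.card = labelDegree n a ∧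
      x • majoranaKet S + y • majoranaKet Sᶜ ∈ (irrep n a).toSubmodule ∧
      x • majoranaKet S + y • majoranaKet Sᶜ ≠ 0 := by
  rcases a with i | ε
  · obtain ⟨S, -, hS⟩ := Finset.exists_subset_card_eq
      (s := (Finset.univ : Finset (Fin (2 * n)))) (n := ((i : Fin (2 * n + 1)) : ℕ))
      (by simpa using Nat.lt_succ_iff.1 i.1.2)
    refine ⟨S, 1, 0, hS, ?_⟩
    rw [one_smul, zero_smul, add_zero, ← majoranaBasis_apply]
    exact ⟨by rw [majoranaBasis_apply]; exact majoranaKet_mem_degreeSpace hS,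
      (majoranaBasis n).ne_zero S⟩
  · obtain ⟨S, -, hS⟩ := Finset.exists_subset_card_eq
      (s := (Finset.univ : Finset (Fin (2 * n)))) (n := n) (by simp; omega)
    refine ⟨S, 1, ((ε : ℤ) : ℂ) * (Complex.I ^ n * ((complementSign S : ℤ) : ℂ)), hS, ?_⟩
    rw [one_smul, mul_smul, ← chirality_majoranaKet hS]
    exact ⟨halfVec_mem hS, halfVec_ne_zero (by omega) hS⟩

/-- A nonzero vector supported on `S` and `Sᶜ` has a nonzero image with the same support, and the
degree of the target must be `|S|` or `|Sᶜ|`. -/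
theorem labelDegree_of_equiv (hn : 2 ≤ n) {a b : IrrepLabel n}
    (φ : (irrep n a).toRepresentation.Equiv (irrep n b).toRepresentation) :
    labelDegree n a = labelDegree n b ∨ labelDegree n a + labelDegree n b = 2 * n := by
  obtain ⟨S, x, y, hS, hmem, hne⟩ := exists_weight_vector hn a
  have hφ : ((φ ⟨_, hmem⟩ : (irrep n b).toSubmodule) : LiouvilleSpace n) ≠ 0 := by
    intro h
    have h1 : φ ⟨_, hmem⟩ = φ 0 := by rw [map_zero]; exact Subtype.ext h
    exact hne (congrArg Subtype.val (EquivLike.injective φ h1))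
  obtain ⟨T, hT⟩ := Finsupp.ne_iff.1 (mt (LinearEquiv.map_eq_zero_iff _).1 hφ :
    (majoranaBasis n).repr _ ≠ 0)
  rw [Finsupp.zero_apply] at hT
  have hcard := mem_degreeSpace.1 (irrep_le_degreeSpace b (φ ⟨_, hmem⟩).2) T hT
  have hle := S.card_le_univ
  rw [Fintype.card_fin] at hle
  rcases equiv_apply_eq hn φ rfl hT with rfl | rfl
  · exact Or.inl (hS.symm.trans hcard)
  · rw [Finset.card_compl, Fintype.card_fin] at hcard
    right; omega

/-- An element sending `|S⟩⟩` to `±|Sᶜ⟩⟩` acts on `halfVec ε S` by a scalar proportional to `ε`. The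
equivalence carries this line to the corresponding line of the other half, so the scalars agree. -/
theorem eq_of_halfRep_equiv (hn : 2 ≤ n) {ε ε' : ℤˣ}
    (φ : (halfRep n ε).toRepresentation.Equiv (halfRep n ε').toRepresentation) : ε = ε' := by
  obtain ⟨S, -, hS⟩ := Finset.exists_subset_card_eq
    (s := (Finset.univ : Finset (Fin (2 * n)))) (n := n) (by simp; omega)
  obtain ⟨U, t, hU⟩ := exists_naturalRep_majoranaKet_eq hn
    (hS.trans (card_compl_of_card hS).symm)
  set κ := Complex.I ^ n * ((complementSign S : ℤ) : ℂ) with hκ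
  have hκ0 : κ ≠ 0 := mul_ne_zero (pow_ne_zero _ Complex.I_ne_zero) (units_cast_ne_zero _)
  have ht0 : ((t : ℤ) : ℂ) ≠ 0 := units_cast_ne_zero t
  have hact : ∀ ε, naturalRep n U (halfVec ε S) =
      (((t : ℤ) : ℂ) * κ⁻¹ * ((ε : ℤ) : ℂ)) • halfVec ε S := by
    intro ε
    rw [naturalRep_halfVec hU, mul_smul, ← halfVec_compl hS, ← hκ, smul_smul, mul_assoc,
      inv_mul_cancel₀ hκ0, mul_one]
  let v : (halfRep n ε).toSubmodule := ⟨halfVec ε S, halfVec_mem hS⟩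
  obtain ⟨x, y, hxy⟩ := equiv_apply_expansion hn φ (S := S) (x := 1)
    (y := ((ε : ℤ) : ℂ) * κ) (v := v)
    (by rw [one_smul, mul_smul, hκ, ← chirality_majoranaKet hS]; rfl)
  obtain ⟨z, hz⟩ := eq_smul_halfVec hS (ε := ε') (x := x) (y := y) (hxy ▸ (φ v).2)
  rw [hz] at hxy
  have hφ : ((φ v : (halfRep n ε').toSubmodule) : LiouvilleSpace n) ≠ 0 := by
    intro h
    have h1 : φ v = φ 0 := by rw [map_zero]; exact Subtype.ext h
    exact halfVec_ne_zero (by omega) hS (congrArg Subtype.val (EquivLike.injective φ h1))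
  have h1 : (⟨naturalRep n U v, (halfRep n ε).apply_mem_toSubmodule U v.2⟩ :
      (halfRep n ε).toSubmodule) = (((t : ℤ) : ℂ) * κ⁻¹ * ((ε : ℤ) : ℂ)) • v :=
    Subtype.ext (hact ε)
  have h2 := equiv_apply_coe φ U v
  rw [h1, map_smul, Submodule.coe_smul] at h2
  have h3 : naturalRep n U (φ v : (halfRep n ε').toSubmodule) =
      (((t : ℤ) : ℂ) * κ⁻¹ * ((ε' : ℤ) : ℂ)) •
        ((φ v : (halfRep n ε').toSubmodule) : LiouvilleSpace n) := by
    rw [hxy, map_smul, hact, smul_comm]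
  rw [h3] at h2
  have h4 := smul_left_injective ℂ hφ h2
  exact Units.ext (Int.cast_injective
    (mul_left_cancel₀ (mul_ne_zero ht0 (inv_ne_zero hκ0)) h4))

theorem nonempty_irrep_equiv_iff (hn : 2 ≤ n) (a b : IrrepLabel n) :
    Nonempty ((irrep n a).toRepresentation.Equiv (irrep n b).toRepresentation) ↔
      a = b ∨ ∃ i j, a = Sum.inl i ∧ b = Sum.inl j ∧
        ((i : Fin (2 * n + 1)) : ℕ) + ((j : Fin (2 * n + 1)) : ℕ) = 2 * n := by
  constructor
  · rintro ⟨φ⟩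
    have hdeg := labelDegree_of_equiv hn φ
    rcases a with i | ε <;> rcases b with j | ε'
    · simp only [labelDegree, Sum.elim_inl] at hdeg
      rcases hdeg with h | h
      · exact Or.inl (congrArg Sum.inl (Subtype.ext (Fin.ext h)))
      · exact Or.inr ⟨i, j, rfl, rfl, h⟩
    · simp only [labelDegree, Sum.elim_inl, Sum.elim_inr] at hdeg
      have := i.2
      omega
    · simp only [labelDegree, Sum.elim_inl, Sum.elim_inr] at hdeg
      have := j.2
      omega
    · exact Or.inl (congrArg Sum.inr (eq_of_halfRep_equiv hn φ))
  · rintro (rfl | ⟨i, j, rfl, rfl, hij⟩)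
    · exact ⟨Representation.Equiv.refl _⟩
    · obtain ⟨φ, -⟩ := exists_hodge_equiv hij
      exact ⟨φ⟩

end Isomorphisms

/-- A finite-dimensional representation spanned by the fixed vectors of an equivariant
conjugate-linear map is real. -/
theorem isRealRep_of_span_fixed {G V : Type*} [Group G] [AddCommGroup V] [Module ℂ V]
    [FiniteDimensional ℂ V] {ρ : Representation ℂ G V} (C : V →ₛₗ[starRingEnd ℂ] V)
    (hC : ∀ g v, C (ρ g v) = ρ g (C v)) (hspan : ⊤ ≤ Submodule.span ℂ {v | C v = v}) :
    IsRealRep ρ := by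
  obtain ⟨d, b, hb⟩ : ∃ (d : ℕ) (b : Module.Basis (Fin d) ℂ V), ∀ i, C (b i) = b i := by
    let b₀ := Module.Basis.ofSpan hspan
    have := Module.Finite.finite_basis b₀
    refine ⟨_, b₀.reindex (Finite.equivFin _), fun i => ?_⟩
    rw [Module.Basis.reindex_apply]
    exact Module.Basis.ofSpan_subset hspan ⟨_, rfl⟩
  refine ⟨d, b, fun g i j => Complex.conj_eq_iff_im.1 ?_⟩
  -- In a basis of fixed vectors `C` conjugates coordinates, so commuting with `C` makes matrix
  -- entries real.
  have hconj : ∀ v, b.repr (C v) i = (starRingEnd ℂ) (b.repr v i) := by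
    intro v
    conv_lhs => rw [← b.sum_repr v, map_sum]
    simp only [map_smulₛₗ, hb, b.repr_sum_self]
  rw [LinearMap.toMatrix_apply, ← hconj, hC, hb]

/-! ### Real and complex conjugate halves. -/

section Reality

variable {n : ℕ}

/-- The conjugate-linear involution of Liouville space given by the adjoint of operators. -/
def liouvilleConj (n : ℕ) : LiouvilleSpace n →ₛₗ[starRingEnd ℂ] LiouvilleSpace n where
  toFun v p := (starRingEnd ℂ) (v (p.2, p.1))
  map_add' v w := by ext p; simp
  map_smul' a v := by ext p; simp

theorem liouvilleConj_liouvilleEquiv (ρ : QubitOp n) :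
    liouvilleConj n (liouvilleEquiv n ρ) = liouvilleEquiv n ρᴴ := rfl

theorem liouvilleConj_liouvilleConj (v : LiouvilleSpace n) :
    liouvilleConj n (liouvilleConj n v) = v := by
  ext p
  simp [liouvilleConj]

theorem naturalRep_liouvilleConj (U : matchgateGroup n) (v : LiouvilleSpace n) :
    liouvilleConj n (naturalRep n U v) = naturalRep n U (liouvilleConj n v) := by
  obtain ⟨ρ, rfl⟩ := (liouvilleEquiv n).surjective v
  rw [liouvilleConj_liouvilleEquiv, naturalRep_liouvilleEquiv, naturalRep_liouvilleEquiv,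
    liouvilleConj_liouvilleEquiv, ← Matrix.star_eq_conjTranspose, ← Matrix.star_eq_conjTranspose,
    map_star (gateConj U)]

theorem liouvilleConj_majoranaKet (S : Finset (Fin (2 * n))) :
    liouvilleConj n (majoranaKet S) = ((revSign S.card : ℤ) : ℂ) • majoranaKet S := by
  rw [majoranaKet_eq, map_smulₛₗ, liouvilleConj_liouvilleEquiv, majoranaProd_conjTranspose,
    units_smul_eq, map_smul, smul_comm]
  simp

theorem liouvilleConj_mem_degreeSpace {i : ℕ} {v : LiouvilleSpace n} (hv : v ∈ degreeSpace n i) :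
    liouvilleConj n v ∈ degreeSpace n i := by
  induction hv using Submodule.span_induction with
  | mem x hx =>
    obtain ⟨S, hS, rfl⟩ := hx
    rw [liouvilleConj_majoranaKet]
    exact Submodule.smul_mem _ _ (majoranaKet_mem_degreeSpace hS)
  | zero => simp
  | add x y _ _ hx hy => rw [map_add]; exact Submodule.add_mem _ hx hy
  | smul a x _ hx => rw [map_smulₛₗ]; exact Submodule.smul_mem _ _ hx

/-- Monomials of `S` and `Sᶜ` have the same adjoint sign in degree `n`, so only the conjugation of
`i^n` contributes. Hence the adjoint preserves the halves for even `n` and exchanges them for odd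
`n`. -/
theorem liouvilleConj_chirality {v : LiouvilleSpace n} (hv : v ∈ degreeSpace n n) :
    liouvilleConj n (chirality n v) = (-1 : ℂ) ^ n • chirality n (liouvilleConj n v) := by
  induction hv using Submodule.span_induction with
  | mem x hx =>
    obtain ⟨S, hS, rfl⟩ := hx
    rw [liouvilleConj_majoranaKet, map_smul, chirality_majoranaKet hS, map_smulₛₗ,
      liouvilleConj_majoranaKet, hS, card_compl_of_card hS, smul_smul, smul_smul, smul_smul]
    congr 1
    rw [map_mul, map_pow, Complex.conj_I, map_intCast, neg_pow]
    ring
  | zero => simp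
  | add x y _ _ hx hy => simp only [map_add, hx, hy, smul_add]
  | smul a x _ hx => rw [map_smul, map_smulₛₗ, hx, map_smulₛₗ, map_smul, smul_comm]

theorem liouvilleConj_mem_halfSpace {ε ε' : ℤˣ} (hε : ((ε' : ℤ) : ℂ) = (-1) ^ n * ((ε : ℤ) : ℂ))
    {v : LiouvilleSpace n} (hv : v ∈ halfSpace n ε) : liouvilleConj n v ∈ halfSpace n ε' := by
  obtain ⟨h1, h2⟩ := mem_halfSpace.1 hv
  refine mem_halfSpace.2 ⟨liouvilleConj_mem_degreeSpace h1, ?_⟩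
  have h := liouvilleConj_chirality h1
  rw [h2, map_smulₛₗ, map_intCast] at h
  rw [hε, mul_smul, h, smul_smul, ← mul_pow]
  simp

theorem liouvilleConj_halfVec (hn : Even n) {ε : ℤˣ} {S : Finset (Fin (2 * n))}
    (hS : S.card = n) :
    liouvilleConj n (halfVec ε S) = ((revSign n : ℤ) : ℂ) • halfVec ε S := by
  rw [halfVec, map_add, map_smulₛₗ, map_intCast,
    liouvilleConj_chirality (majoranaKet_mem_degreeSpace hS), hn.neg_one_pow, one_smul,
    liouvilleConj_majoranaKet, hS, map_smul]
  module

theorem halfRep_isRealRep (hn : Even n) (ε : ℤˣ) : IsRealRep (halfRep n ε).toRepresentation := by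
  have hmem : ∀ v ∈ halfSpace n ε, ((revSign n : ℤ) : ℂ) • liouvilleConj n v ∈ halfSpace n ε :=
    fun v hv => Submodule.smul_mem _ _
      (liouvilleConj_mem_halfSpace (by rw [hn.neg_one_pow, one_mul]) hv)
  -- The factor `revSign n` compensates the adjoint sign of degree `n`, so that the spanning vectors
  -- are fixed.
  let C : (halfRep n ε).toSubmodule →ₛₗ[starRingEnd ℂ] (halfRep n ε).toSubmodule :=
    { toFun v := ⟨((revSign n : ℤ) : ℂ) • liouvilleConj n v, hmem v v.2⟩
      map_add' v w := Subtype.ext (by simp)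
      map_smul' a v := Subtype.ext (by
        simp only [Submodule.coe_smul, map_smulₛₗ]; rw [smul_comm]) }
  refine isRealRep_of_span_fixed C (fun g v => Subtype.ext ?_) ?_
  · change ((revSign n : ℤ) : ℂ) • liouvilleConj n (naturalRep n g v) =
      naturalRep n g (((revSign n : ℤ) : ℂ) • liouvilleConj n v)
    rw [naturalRep_liouvilleConj, map_smul]
  · rintro ⟨v, hv⟩ -
    have hle : halfSpace n ε ≤ (Submodule.span ℂ {v | C v = v}).map
        (halfRep n ε).toSubmodule.subtype := by
      rw [halfSpace_eq_span, Submodule.span_le]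
      rintro _ ⟨S, hS, rfl⟩
      refine ⟨⟨halfVec ε S, halfVec_mem hS⟩, Submodule.subset_span (Subtype.ext ?_), rfl⟩
      change ((revSign n : ℤ) : ℂ) • liouvilleConj n (halfVec ε S) = halfVec ε S
      rw [liouvilleConj_halfVec hn hS, smul_smul, units_cast_mul_self, one_smul]
    obtain ⟨w, hw, rfl⟩ := hle hv
    exact hw

theorem halfRep_areConjugateReps (hn : Odd n) :
    AreConjugateReps (halfRep n 1).toRepresentation (halfRep n (-1)).toRepresentation :=
  ⟨{ toFun v := ⟨liouvilleConj n v,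
        liouvilleConj_mem_halfSpace (by rw [hn.neg_one_pow]; simp) v.2⟩
     invFun v := ⟨liouvilleConj n v,
        liouvilleConj_mem_halfSpace (by rw [hn.neg_one_pow]; simp) v.2⟩
     map_add' v w := Subtype.ext (map_add (liouvilleConj n) (v : LiouvilleSpace n) w)
     map_smul' a v := Subtype.ext (map_smulₛₗ (liouvilleConj n) a (v : LiouvilleSpace n))
     left_inv v := Subtype.ext (liouvilleConj_liouvilleConj (v : LiouvilleSpace n))
     right_inv v := Subtype.ext (liouvilleConj_liouvilleConj (v : LiouvilleSpace n)) },
    fun g v => Subtype.ext (naturalRep_liouvilleConj g v)⟩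

end Reality

end
theorem claim3 (n : ℕ) (hn : 2 ≤ n) :
    -- the Majorana monomials are an orthonormal family of `4 ^ n` vectors
    (∀ S T : Finset (Fin (2 * n)),
      star (majoranaKet S) ⬝ᵥ majoranaKet T = if S = T then 1 else 0) ∧
    ∃ (R : matchgateGroup n →* Matrix.specialOrthogonalGroup (Fin (2 * n)) ℝ)
      (H : ℕ → Subrepresentation (naturalRep n))
      (K : ℤˣ → Subrepresentation (naturalRep n))
      (V : IrrepLabel n → Subrepresentation (naturalRep n)),
      -- the rotation by which the group acts on the Majorana operators
      (∀ (U : matchgateGroup n) (l : Fin (2 * n)),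
        gateOp U * majorana l * (gateOp U)ᴴ =
          ∑ m, (((R U : Matrix (Fin (2 * n)) (Fin (2 * n)) ℝ) m l : ℝ) : ℂ) • majorana m) ∧
      -- `H_i`, `H_{n,1}`, `H_{n,2}` are subrepresentations; `V` lists the claimed irreps
      (∀ i, (H i).toSubmodule = degreeSpace n i) ∧
      (∀ ε, (K ε).toSubmodule = halfSpace n ε) ∧
      (∀ i, V (Sum.inl i) = H (i : Fin (2 * n + 1))) ∧
      (∀ ε, V (Sum.inr ε) = K ε) ∧
      -- `H_i ≅ ⋀^i ℂ^{2n}`, with `e_{m_1} ∧ ⋯ ∧ e_{m_i}` going to `|m_1 ⋯ m_i⟩⟩`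
      (∀ i, ∃ φ : (exteriorPowerRep ((specialOrthogonalRep (2 * n)).comp R) i).Equiv
          (H i).toRepresentation,
        ∀ (S : Finset (Fin (2 * n))) (hS : S.card = i),
          ((φ (exteriorPower.ιMulti ℂ i fun a => Pi.single (S.orderEmbOfFin hS a) 1) :
            (H i).toSubmodule) : LiouvilleSpace n) = majoranaKet S) ∧
      -- `H_n = H_{n,1} ⊕ H_{n,2}`
      K 1 ⊔ K (-1) = H n ∧ K 1 ⊓ K (-1) = ⊥ ∧
      -- the decomposition into irreps
      DirectSum.IsInternal (fun a => (V a).toSubmodule) ∧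
      (∀ a, (V a).toRepresentation.IsIrreducible) ∧
      -- the Hodge star is an isomorphism `H_i ≅ H_{2n-i}`
      (∀ i j, i + j = 2 * n →
        ∃ φ : (H i).toRepresentation.Equiv (H j).toRepresentation,
          ∀ (S : Finset (Fin (2 * n))) (v : (H i).toSubmodule), S.card = i →
            (v : LiouvilleSpace n) = majoranaKet S →
            ((φ v : (H j).toSubmodule) : LiouvilleSpace n) =
              ((complementSign S : ℤ) : ℂ) • majoranaKet Sᶜ) ∧
      -- there are no other isomorphisms between the irreps
      (∀ a b, Nonempty ((V a).toRepresentation.Equiv (V b).toRepresentation) ↔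
        a = b ∨ ∃ i j, a = Sum.inl i ∧ b = Sum.inl j ∧
          ((i : Fin (2 * n + 1)) : ℕ) + ((j : Fin (2 * n + 1)) : ℕ) = 2 * n) ∧
      -- reality
      (Even n → ∀ ε, IsRealRep (K ε).toRepresentation) ∧
      (Odd n → AreConjugateReps (K 1).toRepresentation (K (-1)).toRepresentation) := by
  obtain ⟨R, hR⟩ := exists_rotation_hom n
  exact ⟨majoranaKet_orthonormal, R, degreeRep n, halfRep n, irrep n, hR, fun _ => rfl,
    fun _ => rfl, fun _ => rfl, fun _ => rfl, exists_wedge_equiv hR,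
    Subrepresentation.toSubmodule_injective halfSpace_sup,
    Subrepresentation.toSubmodule_injective halfSpace_inf, irrep_isInternal n,
    irrep_isIrreducible hn, fun _ _ => exists_hodge_equiv, nonempty_irrep_equiv_iff hn,
    halfRep_isRealRep, halfRep_areConjugateReps⟩
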